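/- Let $X_j=Y_j+Z_j$ ($j=1,2,\dots$) be i.i.d. real random variables, where $Y_j$ and $Z_j$ are independent, $Y_j$ has a density $f$ and $Z_j$ has a density $k$ with characteristic function $\phi_k$, and suppose $\mathrm{E}X_1^2<\infty$. Condition W. Let $w$ be a real kernel function whose characteristic function (Fourier transform) $\phi_w$ is real valued, symmetric, integrable and supported in $[-1,1]$; here $w$ and $\phi_w$ are related by $w(x)=\frac1{2\pi}\int_{-\infty}^\infty e^{-itx}\phi_w(t)\,dt$ for almost every $x$ (so $w$ need not be absolutely integrable). Let $\phi_w(0)=1$ and $\phi_w(1-t)=At^\alpha+o(t^\alpha)$ as $t\downarrow0$, for real constants $A$ and $\alpha\ge0$. Condition K. Let $\phi_k(t)\neq0$ for all $t$ and $\phi_k(t)\sim C|t|^{\lambda_0}e^{-|t|^\lambda/\mu}$ as $|t|\to\infty$, for some $\lambda>1$, $\mu>0$, $\lambda_0\in\mathbb{R}$ and $C\in\mathbb{R}$ (necessarily $C\ne0$). For $h>0$ define $$f_{nh}(x)=\frac1{2\pi}\int_{-\infty}^\infty e^{-itx}\,\frac{\phi_w(ht)}{\phi_k(t)}\Big(\frac1n\sum_{j=1}^n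 e^{itX_j}\Big)dt,\qquad F_{nh}(a,b)=\int_a^b f_{nh}(x)\,dx .$$ Theorem. Let $b\in\mathbb{R}$ be fixed, and let $h=h_n>0$ and $a=a_n\in\mathbb{R}$ be such that, as $n\to\infty$, $h\to0$, $a\to-\infty$, $ah^{\lambda-1}\to-\infty$ and $a=o\big(e^{(1-\delta)/(\mu h^\lambda)}\big)$ for some $0<\delta<1$. Then $F_{nh}(a,b)$ is integrable for every $n$, and $$\frac{\sqrt n}{h^{(1+\alpha)\lambda+\lambda_0}\,e^{1/(\mu h^\lambda)}}\,\big(F_{nh}(a,b)-\mathrm{E}\,F_{nh}(a,b)\big)\ \xrightarrow{\ \mathcal D\ }\ N\Big(0,\ \frac{A^2}{2\pi^2C^2}\Big(\frac{\mu}{\lambda}\Big)^{2+2\alpha}\Gamma(\alpha+1)^2\Big),$$ where $N(0,0)$ is the point mass at $0$. -/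

import Mathlib

open MeasureTheory ProbabilityTheory Filter Asymptotics
open scoped Topology

namespace Deconvolution

/-- The measure on the real line with Lebesgue density `k`. -/
noncomputable def densityLaw (k : ℝ → ℝ) : Measure ℝ :=
  volume.withDensity fun x => ENNReal.ofReal (k x)

/-- The characteristic function `t ↦ ∫ exp (i t x) k x dx` of the density `k`. -/
noncomputable def phiK (k : ℝ → ℝ) (t : ℝ) : ℂ := charFun (densityLaw k) t

/-- `phiW` is the characteristic function (Fourier transform) of the kernel function `w`.  The
relation is expressed by Fourier inversion, so that kernels that are not absolutely integrable,
such as `sin x / (π x)`, are included. Since `phiW` will be supported in `[-1, 1]`, every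
absolutely integrable `w` with `phiW t = ∫ exp (i t x) w x dx` satisfies it as well. -/
def IsKernelTransform (w phiW : ℝ → ℝ) : Prop :=
  Integrable phiW ∧
    ∀ᵐ x : ℝ, (w x : ℂ) =
      1 / (2 * Real.pi) * ∫ t : ℝ, Complex.exp (-(Complex.I * t * x)) * phiW t

/-- Condition W on the (real valued) characteristic function `phiW` of the kernel function. -/
structure ConditionW (phiW : ℝ → ℝ) (A α : ℝ) : Prop where
  symm : ∀ t, phiW (-t) = phiW t
  support_subset : Function.support phiW ⊆ Set.Icc (-1) 1
  at_zero : phiW 0 = 1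
  alpha_nonneg : 0 ≤ α
  expansion : (fun t : ℝ => phiW (1 - t) - A * t ^ α) =o[𝓝[>] 0] fun t : ℝ => t ^ α

/-- Condition K on the characteristic function of `k`. The filter `cocompact ℝ` expresses
`|t| → ∞`. -/
structure ConditionK (k : ℝ → ℝ) (C lam0 lam mu : ℝ) : Prop where
  one_lt_lam : 1 < lam
  mu_pos : 0 < mu
  equivalent : phiK k ~[cocompact ℝ]
    fun t : ℝ => ((C * |t| ^ lam0 * Real.exp (-|t| ^ lam / mu) : ℝ) : ℂ)
  ne_zero : ∀ t, phiK k t ≠ 0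

/-- The deconvolution model: `X j = Y j + Z j`, where `Y j` has density `f`, `Z j` has density `k`,
`Y j` and `Z j` are independent, and the observations `X j` are independent (hence i.i.d.).
The sample of size `n` is `X 0, …, X (n - 1)`. -/
structure DeconvolutionModel {Ω : Type*} [MeasurableSpace Ω] (P : Measure Ω) (f k : ℝ → ℝ)
    (X Y Z : ℕ → Ω → ℝ) : Prop where
  measurable_f : Measurable f
  f_nonneg : ∀ x, 0 ≤ f x
  measurable_k : Measurable k
  k_nonneg : ∀ x, 0 ≤ k x
  measurable_Y : ∀ j, Measurable (Y j)
  measurable_Z : ∀ j, Measurable (Z j)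
  law_Y : ∀ j, P.map (Y j) = densityLaw f
  law_Z : ∀ j, P.map (Z j) = densityLaw k
  X_eq : ∀ j ω, X j ω = Y j ω + Z j ω
  indep_Y_Z : ∀ j, IndepFun (Y j) (Z j) P
  indep_X : iIndepFun X P

/-- The empirical characteristic function of `x 0, …, x (n - 1)`. -/
noncomputable def phiEmp (n : ℕ) (x : ℕ → ℝ) (t : ℝ) : ℂ :=
  1 / n * ∑ j ∈ Finset.range n, Complex.exp (Complex.I * t * x j)

/-- The integral defining the deconvolution kernel density estimator at the point `y`, as a
complex number. -/
noncomputable def densityEstimatorC (phiW k : ℝ → ℝ) (n : ℕ) (h : ℝ) (x : ℕ → ℝ) (y : ℝ) : ℂ :=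
  1 / (2 * Real.pi) *
    ∫ t : ℝ, Complex.exp (-(Complex.I * t * y)) * (phiW (h * t) * phiEmp n x t / phiK k t)

/-- The density estimator is real valued if `phiW` is symmetric. -/
theorem densityEstimatorC_im {phiW : ℝ → ℝ} (hW : ∀ t, phiW (-t) = phiW t) (k : ℝ → ℝ)
    (n : ℕ) (h : ℝ) (x : ℕ → ℝ) (y : ℝ) : (densityEstimatorC phiW k n h x y).im = 0 := by
  rw [← Complex.conj_eq_iff_im]
  unfold densityEstimatorC
  rw [map_mul, ← integral_conj, ← integral_neg_eq_self]
  congr 1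
  · simpa using Complex.conj_ofReal 2
  · congr 1
    funext t
    have h1 : (starRingEnd ℂ) (phiK k (-t)) = phiK k t := by
      simp [phiK, charFun_neg]
    simp only [map_mul, map_div₀, h1, ← Complex.exp_conj, map_neg, Complex.conj_I,
      Complex.conj_ofReal, phiEmp, map_sum, map_one, map_natCast, mul_neg, hW]
    simp

/-- The deconvolution kernel density estimator `f_{nh}(y)` (a real number, by
`densityEstimatorC_im`). -/
noncomputable def densityEstimator (phiW k : ℝ → ℝ) (n : ℕ) (h : ℝ) (x : ℕ → ℝ) (y : ℝ) : ℝ :=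
  (densityEstimatorC phiW k n h x y).re

/-- The estimator `F_{nh}(a, b)`, the integral of the density estimator over `[a, b]`. -/
noncomputable def intervalEstimator (phiW k : ℝ → ℝ) (n : ℕ) (h : ℝ) (x : ℕ → ℝ) (a b : ℝ) : ℝ :=
  ∫ y in a..b, densityEstimator phiW k n h x y

end Deconvolution

/-! By Fubini, `F_{nh}(a, b)` is the average of `V (X j)`, where `V` is a Fourier integral of `phiW
(h t) / phiK t` times the transform of the interval (`intervalEstimator_eq`). Since `1 / phiK` grows
like `exp (|t| ^ lam / mu)` up to a power, only `s = h t` near `1` matters on the positive half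
line, and conjugate symmetry accounts for the negative one.

Substitute `s = 1 - h ^ lam * v` there. Because `s ^ lam - 1 ≈ -lam * h ^ lam * v`, Conditions W and
K show that the integrand divided by `rate` converges in `L¹` to `(A / C) v ^ α exp (-lam v / mu)`
on `v > 0` (`tendsto_integral_norm_edgeProfile_sub`). The transform of the interval is a difference
of endpoint exponentials over `i t`. Up to sign and a factor `i`, an endpoint `y` contributes `exp
(i (x - y) / h)` times the Fourier transform of the profile at frequency `h ^ (lam - 1) * (x - y)`.
For `y = b` this frequency tends to `0`, as `lam > 1`, which leaves `K = (A / C) (mu / lam) ^ (α +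
1) Γ(α + 1)`. For `y = a` it tends to infinity, and the Riemann–Lebesgue lemma removes the term. The
part `s ≤ ρ < 1` is exponentially smaller; the growth condition on `a` is needed for `s` near `0`,
where the interval transform may be of size `|b - a|`.

Hence `V x / rate + (K / π) sin ((x - b) / h)` tends to `0` pointwise, and `V / rate` is eventually
bounded uniformly in `x` (`intervalKernel_asymptotics`). The characteristic function of `X 0`
vanishes at infinity, so the sine averages out: the mean tends to `0` and the second moment to `K ^
2 / (2 π ^ 2)` (`tendsto_moments`). The central limit theorem for bounded triangular arrays then
applies (`tendstoInDistribution_array`). -/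

namespace Deconvolution

/-! ### Central limit theorem for bounded triangular arrays -/

/-- Second order Taylor bound for `exp (i y)`. -/
theorem norm_exp_mul_I_sub_le {y : ℝ} (hy : |y| ≤ 1) :
    ‖Complex.exp (y * Complex.I) - (1 + y * Complex.I - y ^ 2 / 2)‖ ≤ |y| ^ 3 := by
  have h := Complex.exp_bound (x := y * Complex.I) (by simpa using hy) (n := 3) (by norm_num)
  simp only [Finset.sum_range_succ, Finset.sum_range_zero, Nat.factorial, norm_mul,
    Complex.norm_real, Complex.norm_I, Real.norm_eq_abs, mul_one] at h
  have e : Complex.exp (y * Complex.I) - (1 + y * Complex.I - y ^ 2 / 2) =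
      Complex.exp (y * Complex.I) - (0 + (y * Complex.I) ^ 0 / ((1 : ℕ) : ℂ)
        + (y * Complex.I) ^ 1 / ((0 + 1 : ℕ) : ℂ)
        + (y * Complex.I) ^ 2 / (((1 + 1) * (0 + 1) : ℕ) : ℂ)) := by
    push_cast
    linear_combination ((y : ℂ) ^ 2 / 2) * Complex.I_sq
  rw [e]
  refine le_trans (by simpa using h) ?_
  have := abs_nonneg y
  have : 0 ≤ |y| ^ 3 := by positivity
  norm_num
  nlinarith

section CLT

variable {Ω : Type*} [MeasurableSpace Ω] {P : Measure Ω} [IsProbabilityMeasure P]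

/-- Remainder estimate for the characteristic function of a bounded centered variable. -/
theorem norm_charFun_sub_le {U : Ω → ℝ} (hU : AEMeasurable U P) {M : ℝ} (hM : ∀ ω, |U ω| ≤ M)
    (h0 : ∫ ω, U ω ∂P = 0) {s : ℝ} (hs : |s| * M ≤ 1) :
    ‖charFun (P.map U) s - (1 - (s ^ 2 / 2 * ∫ ω, U ω ^ 2 ∂P : ℝ))‖ ≤ (|s| * M) ^ 3 := by
  have hi : Integrable U P := Integrable.of_bound hU.aestronglyMeasurable M
    (Eventually.of_forall fun ω => by simpa using hM ω)
  have hi2 : Integrable (fun ω => U ω ^ 2) P :=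
    Integrable.of_bound (hU.pow_const 2).aestronglyMeasurable (M ^ 2)
      (Eventually.of_forall fun ω => by
        simpa using pow_le_pow_left₀ (abs_nonneg _) (hM ω) 2)
  have hie : Integrable (fun ω => Complex.exp ((s * U ω : ℝ) * Complex.I)) P :=
    Integrable.of_bound (by
      refine (Measurable.comp_aemeasurable (g := fun y : ℝ => Complex.exp ((s * y : ℝ) * Complex.I))
        (by fun_prop) hU).aestronglyMeasurable) 1
      (Eventually.of_forall fun ω => by rw [Complex.norm_exp_ofReal_mul_I])
  have hq : Integrable (fun ω => (1 + (s * U ω : ℝ) * Complex.I - ((s * U ω : ℝ) : ℂ) ^ 2 / 2)) P := by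
    refine ((integrable_const _).add ((hi.const_mul s).ofReal.mul_const _)).sub ?_
    have : Integrable (fun ω => (((s ^ 2 / 2) * U ω ^ 2 : ℝ) : ℂ)) P := (hi2.const_mul _).ofReal
    refine this.congr (Eventually.of_forall fun ω => ?_)
    push_cast; ring
  have e1 : charFun (P.map U) s = ∫ ω, Complex.exp ((s * U ω : ℝ) * Complex.I) ∂P := by
    rw [charFun_apply_real, integral_map hU (by fun_prop)]
    simp
  have e2 : (1 - (s ^ 2 / 2 * ∫ ω, U ω ^ 2 ∂P : ℝ) : ℂ) =
      ∫ ω, (1 + (s * U ω : ℝ) * Complex.I - ((s * U ω : ℝ) : ℂ) ^ 2 / 2) ∂P := by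
    have : ∀ ω, (1 + (s * U ω : ℝ) * Complex.I - ((s * U ω : ℝ) : ℂ) ^ 2 / 2) =
        ((1 - (s ^ 2 / 2) * U ω ^ 2 : ℝ) : ℂ) + ((s * U ω : ℝ) : ℂ) * Complex.I := by
      intro ω; push_cast; ring
    simp_rw [this]
    rw [integral_add ((((integrable_const _).sub (hi2.const_mul _))).ofReal)
      ((hi.const_mul s).ofReal.mul_const _), integral_mul_const, integral_complex_ofReal, integral_complex_ofReal,
      integral_sub (integrable_const _) (hi2.const_mul _), integral_const_mul, integral_const_mul,
      h0]
    simp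
  rw [e1, e2, ← integral_sub hie hq]
  have hb : ∀ ω, |s * U ω| ≤ |s| * M := fun ω => by
    rw [abs_mul]; exact mul_le_mul_of_nonneg_left (hM ω) (abs_nonneg _)
  refine (norm_integral_le_of_norm_le_const (C := (|s| * M) ^ 3)
    (Eventually.of_forall fun ω => ?_)).trans (by simp)
  exact (norm_exp_mul_I_sub_le ((hb ω).trans hs)).trans
    (pow_le_pow_left₀ (abs_nonneg _) (hb ω) 3)

/-- Central limit theorem for row sums of a uniformly bounded triangular array whose rows are
functions `T n` of a fixed i.i.d. sequence. -/
theorem tendstoInDistribution_array {X : ℕ → Ω → ℝ} (hindep : iIndepFun X P)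
    (hident : ∀ i, IdentDistrib (X i) (X 0) P P) {T : ℕ → ℝ → ℝ} (hT : ∀ n, Measurable (T n))
    {M : ℝ} (hM : ∀ᶠ n in atTop, ∀ x, |T n x| ≤ M) (h0 : ∀ n, ∫ ω, T n (X 0 ω) ∂P = 0)
    {v : NNReal} (hv : Tendsto (fun n => ∫ ω, T n (X 0 ω) ^ 2 ∂P) atTop (𝓝 v)) :
    TendstoInDistribution (fun (n : ℕ) ω => (√n)⁻¹ * ∑ j ∈ Finset.range n, T n (X j ω)) atTop id
      (fun _ => P) (gaussianReal 0 v) where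
  forall_aemeasurable n := by
    refine .const_mul (Finset.aemeasurable_fun_sum _ fun j _ => ?_) _
    exact (hT n).comp_aemeasurable (hident j).aemeasurable_fst
  tendsto := by
    refine ProbabilityMeasure.tendsto_iff_tendsto_charFun.2 fun t => ?_
    have e : ∀ n : ℕ, charFun (P.map fun ω => (√n)⁻¹ * ∑ j ∈ Finset.range n, T n (X j ω)) t =
        charFun (P.map fun ω => T n (X 0 ω)) ((√n)⁻¹ * t) ^ n := fun n =>
      charFun_inv_sqrt_mul_sum (X := fun j ω => T n (X j ω)) (hindep.comp (fun _ => T n) fun _ => hT n)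
        (fun j => (hident j).comp (hT n))
    have hsq : Tendsto (fun n : ℕ => (√(n : ℝ))⁻¹) atTop (𝓝 0) :=
      tendsto_inv_atTop_zero.comp (Real.tendsto_sqrt_atTop.comp tendsto_natCast_atTop_atTop)
    have key : Tendsto (fun n : ℕ => charFun (P.map fun ω => T n (X 0 ω)) ((√n)⁻¹ * t) ^ n) atTop
        (𝓝 (Complex.exp (-(t ^ 2 / 2 * v : ℝ)))) := by
      -- `(1 + g n) ^ n` tends to `exp z` as soon as `n * g n` tends to `z`.
      have := Complex.tendsto_one_add_pow_exp_of_tendsto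
        (g := fun n : ℕ => charFun (P.map fun ω => T n (X 0 ω)) ((√n)⁻¹ * t) - 1)
        (t := (-(t ^ 2 / 2 * v : ℝ))) ?_
      · simpa using this
      have hlim : Tendsto (fun n : ℕ => ((-(t ^ 2 / 2 * ∫ ω, T n (X 0 ω) ^ 2 ∂P) : ℝ) : ℂ)) atTop
          (𝓝 (-(t ^ 2 / 2 * v : ℝ))) := by
        rw [← Complex.ofReal_neg]
        exact (Complex.continuous_ofReal.tendsto _).comp (hv.const_mul _).neg
      refine hlim.congr_dist ?_
      have hsm : Tendsto (fun n : ℕ => |(√(n : ℝ))⁻¹ * t| * M) atTop (𝓝 0) := by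
        simpa using ((hsq.mul_const t).abs).mul_const M
      -- The third order remainder is at most `n * (|t| M / √n) ^ 3 = (|t| M) ^ 3 / √n`.
      refine squeeze_zero' (Eventually.of_forall fun _ => dist_nonneg)
        (g := fun n : ℕ => (√(n : ℝ))⁻¹ * (|t| * M) ^ 3) ?_ (by simpa using hsq.mul_const _)
      filter_upwards [hM, hsm.eventually_le_const zero_lt_one, eventually_gt_atTop 0] with n hn hn1 hn0
      have hn0' : (0 : ℝ) < n := by exact_mod_cast hn0
      have hb := norm_charFun_sub_le (P := P) (U := fun ω => T n (X 0 ω))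
        ((hT n).comp_aemeasurable (hident 0).aemeasurable_fst) (fun ω => hn _) (h0 n) hn1
      have hs2 : ((√(n : ℝ))⁻¹) ^ 2 = (n : ℝ)⁻¹ := by
        rw [inv_pow, Real.sq_sqrt hn0'.le]
      have e3 : (-(t ^ 2 / 2 * ∫ ω, T n (X 0 ω) ^ 2 ∂P : ℝ) : ℂ) -
          n * (charFun (P.map fun ω => T n (X 0 ω)) ((√n)⁻¹ * t) - 1) =
          -(n * (charFun (P.map fun ω => T n (X 0 ω)) ((√n)⁻¹ * t) -
            (1 - ((((√n)⁻¹ * t) ^ 2 / 2 * ∫ ω, T n (X 0 ω) ^ 2 ∂P : ℝ) : ℂ)))) := by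
        rw [mul_pow, hs2]
        have : (n : ℂ) ≠ 0 := by exact_mod_cast hn0.ne'
        push_cast
        field_simp
        ring
      rw [dist_eq_norm, Complex.ofReal_neg, e3, norm_neg, norm_mul, Complex.norm_natCast]
      calc (n : ℝ) * _ ≤ n * (|(√(n : ℝ))⁻¹ * t| * M) ^ 3 := by gcongr
        _ = (√(n : ℝ))⁻¹ * (n * ((√(n : ℝ))⁻¹) ^ 2) * (|t| * M) ^ 3 := by
          rw [abs_mul, abs_of_nonneg (by positivity : 0 ≤ (√(n : ℝ))⁻¹)]; ring
        _ = _ := by rw [hs2, mul_inv_cancel₀ hn0'.ne', mul_one]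
    simp only [ProbabilityMeasure.coe_mk, e, Measure.map_id, charFun_gaussianReal]
    convert key using 3
    push_cast
    simp
    ring

end CLT

/-! ### The estimator as an average of a Fourier integral kernel -/

/-- The Fourier transform `t ↦ ∫ y in a..b, exp (-i t y)` of the interval from `a` to `b`. -/
noncomputable def intervalTransform (a b t : ℝ) : ℂ :=
  ∫ y in a..b, Complex.exp (-(Complex.I * t * y))

/-- The ratio `phiW (h t) / phiK t` in the integrand of the deconvolution estimator. -/
noncomputable def kernelRatio (phiW k : ℝ → ℝ) (h t : ℝ) : ℂ := phiW (h * t) / phiK k t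

/-- The function `V` with `F_{nh}(a, b) = (1 / n) ∑ V (X j)`, as a complex number. -/
noncomputable def intervalKernelC (phiW k : ℝ → ℝ) (h a b x : ℝ) : ℂ :=
  1 / (2 * Real.pi) *
    ∫ t : ℝ, Complex.exp (Complex.I * t * x) * (kernelRatio phiW k h t * intervalTransform a b t)

/-- The function `V` with `F_{nh}(a, b) = (1 / n) ∑ V (X j)`. -/
noncomputable def intervalKernel (phiW k : ℝ → ℝ) (h a b x : ℝ) : ℝ :=
  (intervalKernelC phiW k h a b x).re

theorem norm_exp_I_mul_mul (t x : ℝ) : ‖Complex.exp (Complex.I * t * x)‖ = 1 := by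
  rw [show Complex.I * t * x = ((t * x : ℝ) : ℂ) * Complex.I by push_cast; ring]
  exact Complex.norm_exp_ofReal_mul_I _

theorem norm_exp_neg_I_mul_mul (t x : ℝ) : ‖Complex.exp (-(Complex.I * t * x))‖ = 1 := by
  rw [show -(Complex.I * t * x) = ((-(t * x) : ℝ) : ℂ) * Complex.I by push_cast; ring]
  exact Complex.norm_exp_ofReal_mul_I _

theorem norm_intervalTransform_le (a b t : ℝ) : ‖intervalTransform a b t‖ ≤ |b - a| := by
  unfold intervalTransform
  simpa using intervalIntegral.norm_integral_le_of_norm_le_const (a := a) (b := b) (C := 1)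
    (f := fun y : ℝ => Complex.exp (-(Complex.I * t * y)))
    fun y _ => (norm_exp_neg_I_mul_mul t y).le

theorem intervalTransform_eq (a b : ℝ) {t : ℝ} (ht : t ≠ 0) :
    intervalTransform a b t =
      (Complex.exp (-(Complex.I * t * a)) - Complex.exp (-(Complex.I * t * b))) /
        (Complex.I * t) := by
  have hc : -(Complex.I * t) ≠ 0 := by simp [ht]
  unfold intervalTransform
  have e : ∀ z : ℝ, -(Complex.I * t * z) = -(Complex.I * t) * z := fun z => by ring
  simp_rw [e]
  rw [integral_exp_mul_complex hc, div_eq_div_iff hc (neg_ne_zero.1 hc)]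
  ring

/-- Unlike `|b - a|`, this bound does not grow as `a → -∞`; it serves away from the origin. -/
theorem norm_intervalTransform_le_div (a b : ℝ) {t : ℝ} (ht : t ≠ 0) :
    ‖intervalTransform a b t‖ ≤ 2 / |t| := by
  rw [intervalTransform_eq a b ht, norm_div, norm_mul, Complex.norm_I, Complex.norm_real, one_mul,
    Real.norm_eq_abs]
  gcongr
  refine (norm_sub_le _ _).trans ?_
  rw [norm_exp_neg_I_mul_mul, norm_exp_neg_I_mul_mul]
  norm_num

theorem continuous_intervalTransform (a b : ℝ) : Continuous (intervalTransform a b) := by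
  unfold intervalTransform
  exact intervalIntegral.continuous_parametric_intervalIntegral_of_continuous' (by fun_prop) a b

theorem intervalTransform_neg (a b t : ℝ) :
    intervalTransform a b (-t) = (starRingEnd ℂ) (intervalTransform a b t) := by
  unfold intervalTransform
  rw [← intervalIntegral.intervalIntegral_conj]
  congr 1
  funext y
  simp [← Complex.exp_conj]

section Kernel

variable {phiW k : ℝ → ℝ}

theorem phiK_neg (t : ℝ) : phiK k (-t) = (starRingEnd ℂ) (phiK k t) := by
  simp [phiK, charFun_neg]

theorem continuous_phiK [IsFiniteMeasure (densityLaw k)] : Continuous (phiK k) := by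
  unfold phiK; exact continuous_charFun

theorem kernelRatio_neg (hW : ∀ t, phiW (-t) = phiW t) (h t : ℝ) :
    kernelRatio phiW k h (-t) = (starRingEnd ℂ) (kernelRatio phiW k h t) := by
  simp [kernelRatio, phiK_neg, hW]

/-- The numerator vanishes outside the compact interval `|t| ≤ 1 / h`, on which the continuous
function `1 / phiK` is bounded. -/
theorem integrable_kernelRatio [IsFiniteMeasure (densityLaw k)] (hi : Integrable phiW)
    (hs : Function.support phiW ⊆ Set.Icc (-1) 1) (h0 : ∀ t, phiK k t ≠ 0) {h : ℝ} (hh : 0 < h) :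
    Integrable (kernelRatio phiW k h) := by
  have hc : Continuous fun t => (phiK k t)⁻¹ := continuous_phiK.inv₀ h0
  obtain ⟨B, hB⟩ := (isCompact_Icc (a := -h⁻¹) (b := h⁻¹)).exists_bound_of_continuousOn
    hc.continuousOn
  have hi' : Integrable fun t => (phiW (h * t) : ℂ) := (hi.comp_mul_left' hh.ne').ofReal
  refine (hi'.norm.mul_const B).mono' (hi'.aestronglyMeasurable.mul hc.aestronglyMeasurable)
    (Eventually.of_forall fun t => ?_)
  change ‖(phiW (h * t) : ℂ) / phiK k t‖ ≤ ‖(phiW (h * t) : ℂ)‖ * B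
  rw [div_eq_mul_inv, norm_mul]
  by_cases ht : phiW (h * t) = 0
  · simp [ht]
  · have := hs (Function.mem_support.2 ht)
    refine mul_le_mul_of_nonneg_left (hB t ⟨?_, ?_⟩) (norm_nonneg _)
    · rw [neg_le, ← mul_le_mul_iff_right₀ hh, mul_inv_cancel₀ hh.ne']; linarith [this.1]
    · rw [← mul_le_mul_iff_right₀ hh, mul_inv_cancel₀ hh.ne']; exact this.2

theorem integrable_intervalKernel_integrand {h : ℝ} (hr : Integrable (kernelRatio phiW k h))
    (a b x : ℝ) :
    Integrable fun t : ℝ =>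
      Complex.exp (Complex.I * t * x) * (kernelRatio phiW k h t * intervalTransform a b t) := by
  have h1 : Integrable fun t => kernelRatio phiW k h t * intervalTransform a b t :=
    hr.mul_bdd (c := |b - a|) (continuous_intervalTransform a b).aestronglyMeasurable
      (Eventually.of_forall fun t => norm_intervalTransform_le a b t)
  exact h1.bdd_mul (c := 1) (by fun_prop) (Eventually.of_forall fun t => (norm_exp_I_mul_mul t x).le)

theorem norm_intervalKernel_le {h : ℝ} (hr : Integrable (kernelRatio phiW k h)) (a b x : ℝ) :
    |intervalKernel phiW k h a b x| ≤
      ‖(1 / (2 * Real.pi) : ℂ)‖ * ∫ t, ‖kernelRatio phiW k h t‖ * |b - a| := by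
  refine (Complex.abs_re_le_norm _).trans ?_
  rw [intervalKernelC, norm_mul]
  refine mul_le_mul_of_nonneg_left (norm_integral_le_of_norm_le (hr.norm.mul_const _)
    (Eventually.of_forall fun t => ?_)) (norm_nonneg _)
  rw [norm_mul, norm_exp_I_mul_mul, one_mul, norm_mul]
  exact mul_le_mul_of_nonneg_left (norm_intervalTransform_le a b t) (norm_nonneg _)

theorem continuous_intervalKernel {h : ℝ} (hr : Integrable (kernelRatio phiW k h)) (a b : ℝ) :
    Continuous (intervalKernel phiW k h a b) := by
  unfold intervalKernel intervalKernelC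
  refine Complex.continuous_re.comp (continuous_const.mul ?_)
  refine continuous_of_dominated
    (bound := fun t => ‖kernelRatio phiW k h t * intervalTransform a b t‖)
    (fun x => (integrable_intervalKernel_integrand hr a b x).aestronglyMeasurable) (fun x => ?_) ?_ ?_
  · exact Eventually.of_forall fun t => by rw [norm_mul, norm_exp_I_mul_mul, one_mul]
  · simpa using (integrable_intervalKernel_integrand hr a b 0).norm
  · exact Eventually.of_forall fun t => by fun_prop

/-- The interval estimator is an average of the functions `intervalKernel` of the observations. -/
theorem intervalEstimator_eq (hW : ∀ t, phiW (-t) = phiW t) {h : ℝ}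
    (hr : Integrable (kernelRatio phiW k h)) (n : ℕ) (x : ℕ → ℝ) (a b : ℝ) :
    intervalEstimator phiW k n h x a b =
      1 / n * ∑ j ∈ Finset.range n, intervalKernel phiW k h a b (x j) := by
  -- The complex integral is already real, so the identity can be proved in `ℂ` before taking real
  -- parts.
  have hre : ∀ y, ((densityEstimator phiW k n h x y : ℝ) : ℂ) = densityEstimatorC phiW k n h x y :=
    fun y => Complex.ext (by simp [densityEstimator]) (by
      simpa using (densityEstimatorC_im hW k n h x y).symm)
  have hE : ∀ t, ‖phiEmp n x t‖ ≤ ‖(1 / n : ℂ)‖ * n := fun t => by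
    rw [phiEmp, norm_mul]
    refine mul_le_mul_of_nonneg_left ((norm_sum_le _ _).trans ?_) (norm_nonneg _)
    simp [norm_exp_I_mul_mul]
  have hEc : Continuous (phiEmp n x) := by unfold phiEmp; fun_prop
  have hg : Integrable fun t => kernelRatio phiW k h t * phiEmp n x t :=
    hr.mul_bdd hEc.aestronglyMeasurable (Eventually.of_forall hE)
  have : IsFiniteMeasure ((volume : Measure ℝ).restrict (Set.uIoc a b)) := ⟨by simp [Set.uIoc]⟩
  -- Integrability on the product, which permits exchanging the integrals over `y` and `t`.
  have hF : Integrable (Function.uncurry fun (y t : ℝ) => Complex.exp (-(Complex.I * t * y)) *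
      (kernelRatio phiW k h t * phiEmp n x t))
      ((volume.restrict (Set.uIoc a b)).prod volume) := by
    refine (hg.comp_snd (volume.restrict (Set.uIoc a b))).bdd_mul (c := 1) ?_ ?_
    · exact Continuous.aestronglyMeasurable (by fun_prop)
    · exact Eventually.of_forall fun p => (norm_exp_neg_I_mul_mul p.2 p.1).le
  have key : ((intervalEstimator phiW k n h x a b : ℝ) : ℂ) =
      1 / n * ∑ j ∈ Finset.range n, intervalKernelC phiW k h a b (x j) := by
    rw [intervalEstimator, ← intervalIntegral.integral_ofReal]
    simp_rw [hre, densityEstimatorC, intervalKernelC]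
    rw [intervalIntegral.integral_const_mul, ← Finset.mul_sum, ← integral_finsetSum _ fun j _ =>
      integrable_intervalKernel_integrand hr a b (x j), mul_left_comm, ← integral_const_mul]
    congr 1
    have e : ∀ y t : ℝ, Complex.exp (-(Complex.I * t * y)) *
        (phiW (h * t) * phiEmp n x t / phiK k t) = Complex.exp (-(Complex.I * t * y)) *
        (kernelRatio phiW k h t * phiEmp n x t) := fun y t => by rw [kernelRatio]; ring
    simp_rw [e]
    rw [intervalIntegral_integral_swap hF]
    refine integral_congr_ae (Eventually.of_forall fun t => ?_)
    simp only [intervalIntegral.integral_mul_const, phiEmp, intervalTransform]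
    rw [← Finset.sum_mul]
    ring
  have := congrArg Complex.re key
  rw [Complex.ofReal_re] at this
  rw [this, show (1 / n : ℂ) = ((1 / n : ℝ) : ℂ) by push_cast; rfl, Complex.re_ofReal_mul,
    Complex.re_sum]
  rfl

/-- By symmetry `intervalKernel` is an integral over the positive half line. -/
theorem intervalKernel_eq_integral_Ioi (hW : ∀ t, phiW (-t) = phiW t) {h : ℝ} (hh : 0 < h)
    (hr : Integrable (kernelRatio phiW k h)) (a b x : ℝ) :
    intervalKernel phiW k h a b x = 1 / Real.pi * (∫ s in Set.Ioi (0 : ℝ),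
      Complex.exp (Complex.I * (s / h : ℝ) * x) * (phiW s / phiK k (s / h) *
        ((h : ℂ)⁻¹ * intervalTransform a b (s / h)))).re := by
  set F : ℝ → ℂ := fun t =>
    Complex.exp (Complex.I * t * x) * (kernelRatio phiW k h t * intervalTransform a b t) with hFdef
  have hF : Integrable F := integrable_intervalKernel_integrand hr a b x
  have hneg : ∀ t, F (-t) = (starRingEnd ℂ) (F t) := fun t => by
    simp only [hFdef, kernelRatio_neg hW, intervalTransform_neg, map_mul, ← Complex.exp_conj,
      Complex.conj_I, Complex.conj_ofReal]
    simp
  -- The real part of `F` is even, so its integral is twice that over the half line.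
  have habs : ∀ t, (F |t|).re = (F t).re := fun t => by
    rcases abs_choice t with h | h <;> rw [h]
    rw [hneg, Complex.conj_re]
  have h1 : (∫ t, F t).re = 2 * (∫ t in Set.Ioi (0 : ℝ), F t).re := by
    have e1 := _root_.integral_re (𝕜 := ℂ) hF
    have e2 := _root_.integral_re (𝕜 := ℂ) (hF.restrict (s := Set.Ioi (0 : ℝ)))
    simp only [RCLike.re_eq_complex_re] at e1 e2
    rw [← e1, ← e2, ← integral_comp_abs (f := fun t => (F t).re)]
    simp_rw [habs]
  have h2 : ∫ t in Set.Ioi (0 : ℝ), F t = ∫ s in Set.Ioi (0 : ℝ),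
      Complex.exp (Complex.I * (s / h : ℝ) * x) * (phiW s / phiK k (s / h) *
        ((h : ℂ)⁻¹ * intervalTransform a b (s / h))) := by
    have := integral_comp_mul_left_Ioi' F 0 (inv_pos.2 hh)
    rw [mul_zero] at this
    rw [← this, ← integral_smul]
    refine integral_congr_ae (Eventually.of_forall fun s => ?_)
    have e : h⁻¹ * s = s / h := by ring
    simp only [hFdef, e, kernelRatio, mul_div_cancel₀ _ hh.ne', Complex.real_smul,
      Complex.ofReal_inv]
    ring
  rw [intervalKernel, intervalKernelC, show (1 / (2 * Real.pi) : ℂ) = ((1 / (2 * Real.pi) : ℝ) : ℂ) by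
    push_cast; rfl, Complex.re_ofReal_mul, h1, h2, ← mul_assoc]
  congr 1
  field_simp

end Kernel

/-! ### Tail behaviour and reciprocal of the characteristic function of `k` -/

theorem tendsto_rpow_mul_exp_neg_mul_rpow (p : ℝ) {c q : ℝ} (hc : 0 < c) (hq : 0 < q) :
    Tendsto (fun y : ℝ => y ^ p * Real.exp (-(c * y ^ q))) atTop (𝓝 0) := by
  refine ((tendsto_rpow_mul_exp_neg_mul_atTop_nhds_zero (p / q) c hc).comp
    (tendsto_rpow_atTop hq)).congr' ?_
  filter_upwards [eventually_ge_atTop 0] with y hy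
  simp only [Function.comp_apply]
  rw [← Real.rpow_mul hy, mul_div_cancel₀ _ hq.ne', neg_mul]

theorem tendsto_rpow_mul_exp_neg_div_rpow (p : ℝ) {c q : ℝ} (hc : 0 < c) (hq : 0 < q) :
    Tendsto (fun h : ℝ => h ^ p * Real.exp (-(c / h ^ q))) (𝓝[>] 0) (𝓝 0) := by
  refine ((tendsto_rpow_mul_exp_neg_mul_rpow (-p) hc hq).comp tendsto_inv_nhdsGT_zero).congr' ?_
  filter_upwards [self_mem_nhdsWithin] with h hh
  have hh : 0 < h := hh
  simp only [Function.comp_apply]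
  rw [Real.inv_rpow hh.le, Real.inv_rpow hh.le, Real.rpow_neg hh.le, inv_inv, div_eq_mul_inv]

section CharFun

variable {k : ℝ → ℝ} {C lam0 lam mu : ℝ}

/-- A function equivalent to zero is eventually zero, but `phiK` has no zeros. -/
theorem ConditionK.C_ne_zero (hK : ConditionK k C lam0 lam mu) : C ≠ 0 := by
  rintro rfl
  have h := hK.equivalent
  have : (fun t : ℝ => (((0 : ℝ) * |t| ^ lam0 * Real.exp (-|t| ^ lam / mu) : ℝ) : ℂ)) = 0 := by
    funext t; simp
  rw [this, isEquivalent_zero_iff_eventually_zero] at h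
  obtain ⟨t, ht⟩ := h.exists
  exact hK.ne_zero t ht

/-- The quotient of the characteristic function and its tail model. -/
noncomputable def tailRatio (k : ℝ → ℝ) (C lam0 lam mu t : ℝ) : ℂ :=
  phiK k t / ((C * |t| ^ lam0 * Real.exp (-|t| ^ lam / mu) : ℝ) : ℂ)

theorem tailModel_ne_zero (hC : C ≠ 0) {t : ℝ} (ht : t ≠ 0) :
    ((C * |t| ^ lam0 * Real.exp (-|t| ^ lam / mu) : ℝ) : ℂ) ≠ 0 := by
  have := Real.rpow_pos_of_pos (abs_pos.2 ht) lam0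
  exact_mod_cast mul_ne_zero (mul_ne_zero hC this.ne') (Real.exp_pos _).ne'

theorem phiK_eq_tailRatio_mul (hC : C ≠ 0) {t : ℝ} (ht : t ≠ 0) :
    phiK k t = tailRatio k C lam0 lam mu t *
      ((C * |t| ^ lam0 * Real.exp (-|t| ^ lam / mu) : ℝ) : ℂ) := by
  rw [tailRatio, div_mul_cancel₀ _ (tailModel_ne_zero hC ht)]

theorem eventually_ne_zero_cocompact : ∀ᶠ t : ℝ in cocompact ℝ, t ≠ 0 :=
  isCompact_singleton.compl_mem_cocompact

theorem ConditionK.tendsto_tailRatio (hK : ConditionK k C lam0 lam mu) :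
    Tendsto (tailRatio k C lam0 lam mu) (cocompact ℝ) (𝓝 1) :=
  (isEquivalent_iff_tendsto_one (eventually_ne_zero_cocompact.mono fun _ ht =>
    tailModel_ne_zero hK.C_ne_zero ht)).1 hK.equivalent

theorem ConditionK.tendsto_phiK (hK : ConditionK k C lam0 lam mu) :
    Tendsto (phiK k) (cocompact ℝ) (𝓝 0) := by
  refine hK.equivalent.symm.tendsto_nhds ?_
  rw [← Complex.ofReal_zero]
  refine (Complex.continuous_ofReal.tendsto _).comp ?_
  have h := ((tendsto_rpow_mul_exp_neg_mul_rpow lam0 (inv_pos.2 hK.mu_pos)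
    (zero_lt_one.trans hK.one_lt_lam)).comp (tendsto_norm_cocompact_atTop (E := ℝ))).const_mul C
  rw [mul_zero] at h
  refine h.congr fun t => ?_
  simp only [Function.comp_apply, Real.norm_eq_abs]
  rw [neg_div, div_eq_inv_mul, mul_assoc]

/-- Global bound for the reciprocal of the characteristic function. -/
theorem ConditionK.exists_norm_inv_le [IsFiniteMeasure (densityLaw k)]
    (hK : ConditionK k C lam0 lam mu) {γ : ℝ} (hγ : 1 < γ) :
    ∃ M, 0 ≤ M ∧ ∀ t, ‖(phiK k t)⁻¹‖ ≤ M * Real.exp (γ * |t| ^ lam / mu) := by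
  have hlam : 0 < lam := zero_lt_one.trans hK.one_lt_lam
  have hmu := hK.mu_pos
  -- Since `γ > 1`, the extra exponential decay absorbs the power `|t| ^ (-lam0)`. So `ψ` is
  -- continuous, vanishes at infinity, and is therefore bounded.
  set ψ : ℝ → ℝ := fun t => ‖(phiK k t)⁻¹‖ * Real.exp (-(γ * |t| ^ lam / mu)) with hψ
  have hc : Continuous ψ := by
    refine (continuous_phiK.inv₀ hK.ne_zero).norm.mul (Real.continuous_exp.comp ?_)
    exact ((continuous_const.mul (continuous_abs.rpow_const fun _ => Or.inr hlam.le)).div_const _).neg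
  have hlim : Tendsto ψ (cocompact ℝ) (𝓝 0) := by
    have h1 := ((tendsto_rpow_mul_exp_neg_mul_rpow (-lam0) (div_pos (sub_pos.2 hγ) hmu)
      hlam).comp (tendsto_norm_cocompact_atTop (E := ℝ))).const_mul |C|⁻¹
    have h2 := (hK.tendsto_tailRatio.inv₀ one_ne_zero).norm.mul h1
    simp only [mul_zero] at h2
    refine h2.congr' ?_
    filter_upwards [eventually_ne_zero_cocompact] with t ht
    simp only [Function.comp_apply, hψ, Real.norm_eq_abs]
    rw [phiK_eq_tailRatio_mul (lam0 := lam0) (lam := lam) (mu := mu) hK.C_ne_zero ht, mul_inv,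
      norm_mul, mul_assoc, ← Complex.ofReal_inv, Complex.norm_real, Real.norm_eq_abs, mul_inv,
      mul_inv, abs_mul, abs_mul, ← Real.exp_neg, Real.abs_exp, ← Real.rpow_neg (abs_nonneg t),
      abs_of_nonneg (Real.rpow_nonneg (abs_nonneg t) _), abs_inv, mul_assoc, mul_assoc,
      ← Real.exp_add]
    congr 5
    ring
  have hev : ∀ᶠ t in cocompact ℝ, ψ t ≤ 1 := hlim.eventually_le_const zero_lt_one
  obtain ⟨S, hS, hSc⟩ := mem_cocompact.1 hev
  obtain ⟨B, hB⟩ := hS.exists_bound_of_continuousOn hc.continuousOn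
  refine ⟨max B 1, by positivity, fun t => ?_⟩
  have : ψ t ≤ max B 1 := by
    by_cases ht : t ∈ S
    · exact (le_abs_self _).trans ((hB t ht).trans (le_max_left _ _))
    · exact (hSc ht).trans (le_max_right _ _)
  simp only [hψ] at this
  rwa [Real.exp_neg, ← div_eq_mul_inv, div_le_iff₀ (Real.exp_pos _)] at this

end CharFun

/-! ### The normalized integrand near the edge `s = 1` -/

/-- The normalization of the deconvolution kernel. -/
noncomputable def rate (α lam0 lam mu h : ℝ) : ℝ :=
  h ^ ((1 + α) * lam + lam0) * Real.exp (1 / (mu * h ^ lam))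

theorem rate_pos {α lam0 lam mu h : ℝ} (hh : 0 < h) : 0 < rate α lam0 lam mu h :=
  mul_pos (Real.rpow_pos_of_pos hh _) (Real.exp_pos _)

section Edge

variable (phiW k : ℝ → ℝ) (C α lam0 lam mu ρ : ℝ)

/-- The integrand `phiW s / phiK (s / h) / s`, cut off outside `ρ < s < 1`. -/
noncomputable def edgeIntegrand (h : ℝ) : ℝ → ℂ :=
  (Set.Ioo ρ 1).indicator fun s => phiW s * (phiK k (s / h) * s)⁻¹

/-- The integrand near `s = 1` in the variable `v = (1 - s) / h ^ lam`, normalized. -/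
noncomputable def edgeProfile (h v : ℝ) : ℂ :=
  ((h ^ lam / rate α lam0 lam mu h : ℝ) : ℂ) * edgeIntegrand phiW k ρ h (1 - h ^ lam * v)

variable {phiW k C α lam0 lam mu ρ}

theorem integrable_edgeIntegrand [IsFiniteMeasure (densityLaw k)] (hi : Integrable phiW)
    (h0 : ∀ t, phiK k t ≠ 0) (hρ : 0 < ρ) (h : ℝ) : Integrable (edgeIntegrand phiW k ρ h) := by
  rw [edgeIntegrand, integrable_indicator_iff measurableSet_Ioo]
  have : IntegrableOn (fun s : ℝ => (phiW s : ℂ) * (phiK k (s / h) * s)⁻¹) (Set.Icc ρ 1) := by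
    refine IntegrableOn.mul_continuousOn hi.ofReal.integrableOn ?_ isCompact_Icc
    refine ContinuousOn.inv₀ (Continuous.continuousOn ?_) fun s hs => ?_
    · exact (continuous_phiK.comp (continuous_id.div_const h)).mul Complex.continuous_ofReal
    · exact mul_ne_zero (h0 _) (by exact_mod_cast (hρ.trans_le hs.1).ne')
  exact this.mono_set Set.Ioo_subset_Icc_self

theorem integrable_edgeProfile [IsFiniteMeasure (densityLaw k)] (hi : Integrable phiW)
    (h0 : ∀ t, phiK k t ≠ 0) (hρ : 0 < ρ) {h : ℝ} (hh : 0 < h) :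
    Integrable (edgeProfile phiW k α lam0 lam mu ρ h) := by
  have := ((integrable_edgeIntegrand hi h0 hρ h).comp_sub_left 1).comp_mul_left'
    (Real.rpow_pos_of_pos hh lam).ne'
  exact this.const_mul _

/-- The power in `rate` collects `h ^ lam` from the Jacobian, `h ^ (lam * α)` from `(1 - s) ^ α` and
`h ^ lam0` from the tail of `phiK`. Its exponential is the value of `exp ((s / h) ^ lam / mu)` at `s
= 1`, which leaves the difference `s ^ lam - 1`. -/
theorem edgeProfile_real_identity {h v s : ℝ} (hh : 0 < h) (hv : 0 < v)
    (hs : 0 < s) :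
    h ^ lam / rate α lam0 lam mu h * ((h ^ lam * v) ^ α *
      ((s / h) ^ lam0 * Real.exp (-(s / h) ^ lam / mu) * s)⁻¹) =
    v ^ α * s ^ (-(lam0 + 1)) * Real.exp ((s ^ lam - 1) / h ^ lam / mu) := by
  have e1 : (h ^ lam * v) ^ α = h ^ (lam * α) * v ^ α := by
    rw [Real.mul_rpow (Real.rpow_nonneg hh.le _) hv.le, ← Real.rpow_mul hh.le]
  have e2 : Real.exp ((s ^ lam - 1) / h ^ lam / mu) =
      (Real.exp (-(s / h) ^ lam / mu))⁻¹ * (Real.exp (1 / (mu * h ^ lam)))⁻¹ := by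
    rw [← Real.exp_neg, ← Real.exp_neg, ← Real.exp_add, Real.div_rpow hs.le hh.le]
    congr 1
    rw [mul_comm mu, ← div_div]
    ring
  have e3 : h ^ ((1 + α) * lam + lam0) = h ^ lam * h ^ (lam * α) * h ^ lam0 := by
    rw [← Real.rpow_add hh, ← Real.rpow_add hh]; congr 1; ring
  rw [rate, e1, e2, e3, Real.div_rpow hs.le hh.le, Real.rpow_neg hs.le, Real.rpow_add_one hs.ne']
  have := Real.rpow_pos_of_pos hh lam
  have := Real.rpow_pos_of_pos hh (lam * α)
  have := Real.rpow_pos_of_pos hh lam0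
  have := Real.rpow_pos_of_pos hs lam0
  have := Real.exp_pos (-(s / h) ^ lam / mu)
  have := Real.exp_pos (1 / (mu * h ^ lam))
  field_simp

/-- Explicit form of the normalized integrand. -/
theorem edgeProfile_eq (hC : C ≠ 0) (hρ : 0 < ρ) {h v : ℝ} (hh : 0 < h)
    (hv : 0 < v) (hvρ : ρ < 1 - h ^ lam * v) :
    edgeProfile phiW k α lam0 lam mu ρ h v =
      ((phiW (1 - h ^ lam * v) / (h ^ lam * v) ^ α * C⁻¹ *
        (v ^ α * (1 - h ^ lam * v) ^ (-(lam0 + 1)) *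
          Real.exp (((1 - h ^ lam * v) ^ lam - 1) / h ^ lam / mu)) : ℝ) : ℂ) *
        (tailRatio k C lam0 lam mu ((1 - h ^ lam * v) / h))⁻¹ := by
  have hx : 0 < h ^ lam * v := mul_pos (Real.rpow_pos_of_pos hh _) hv
  have hs : 0 < 1 - h ^ lam * v := hρ.trans hvρ
  rw [edgeProfile, edgeIntegrand, Set.indicator_of_mem (Set.mem_Ioo.2 ⟨hvρ, by linarith⟩),
    phiK_eq_tailRatio_mul (lam0 := lam0) (lam := lam) (mu := mu) hC (div_pos hs hh).ne',
    abs_of_pos (div_pos hs hh), ← edgeProfile_real_identity hh hv hs]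
  have := Real.rpow_pos_of_pos hx α
  have h1 : (((h ^ lam * v) ^ α : ℝ) : ℂ) ≠ 0 := by exact_mod_cast this.ne'
  simp only [Complex.ofReal_mul, Complex.ofReal_inv, Complex.ofReal_div, mul_inv]
  field_simp

theorem edgeProfile_eq_zero {h v : ℝ} (hh : 0 < h) (hv : v ≤ 0) :
    edgeProfile phiW k α lam0 lam mu ρ h v = 0 := by
  rw [edgeProfile, edgeIntegrand, Set.indicator_of_notMem, mul_zero]
  rintro ⟨-, h2⟩
  have := mul_nonpos_of_nonneg_of_nonpos (Real.rpow_pos_of_pos hh lam).le hv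
  linarith

theorem tendsto_rpow_nhdsGT_zero {q : ℝ} (hq : 0 < q) :
    Tendsto (fun h : ℝ => h ^ q) (𝓝[>] 0) (𝓝[>] 0) := by
  refine tendsto_nhdsWithin_iff.2 ⟨?_, ?_⟩
  · have := (Real.continuousAt_rpow_const 0 q (Or.inr hq.le)).tendsto
    rw [Real.zero_rpow hq.ne'] at this
    exact this.mono_left nhdsWithin_le_nhds
  · filter_upwards [self_mem_nhdsWithin] with h hh using Real.rpow_pos_of_pos hh q

/-- A difference quotient at `0` of `x ↦ (1 - x * v) ^ lam`, taken along `x = h ^ lam`. -/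
theorem tendsto_exponent (hlam : 0 < lam) (v : ℝ) :
    Tendsto (fun h : ℝ => ((1 - h ^ lam * v) ^ lam - 1) / h ^ lam / mu) (𝓝[>] 0)
      (𝓝 (-(lam * v / mu))) := by
  have hd : HasDerivAt (fun x : ℝ => (1 - x * v) ^ lam) (-(lam * v)) 0 := by
    have h1 : HasDerivAt (fun x : ℝ => 1 - x * v) (-v) 0 := by
      simpa using ((hasDerivAt_id (0 : ℝ)).mul_const v).const_sub 1
    have := h1.rpow_const (p := lam) (Or.inl (by simp))
    simp only [zero_mul, sub_zero, Real.one_rpow, mul_one] at this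
    convert this using 1
    ring
  have h2 := (hasDerivAt_iff_tendsto_slope.1 hd).comp
    ((tendsto_rpow_nhdsGT_zero hlam).mono_right (nhdsGT_le_nhdsNE 0))
  have h3 := h2.div_const mu
  rw [neg_div] at h3
  refine h3.congr fun h => ?_
  simp [slope_def_field]

/-- Pointwise limit of the normalized integrand. -/
theorem tendsto_edgeProfile {A : ℝ} (hW : ConditionW phiW A α) (hK : ConditionK k C lam0 lam mu)
    (hρ : 0 < ρ) (hρ1 : ρ < 1) {v : ℝ} (hv : 0 < v) :
    Tendsto (fun h => edgeProfile phiW k α lam0 lam mu ρ h v) (𝓝[>] 0)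
      (𝓝 ((A / C * (v ^ α * Real.exp (-(lam / mu * v))) : ℝ) : ℂ)) := by
  have hlam : 0 < lam := zero_lt_one.trans hK.one_lt_lam
  have hx : Tendsto (fun h : ℝ => h ^ lam * v) (𝓝[>] 0) (𝓝[>] 0) := by
    have := (tendsto_nhdsWithin_iff.1 (tendsto_rpow_nhdsGT_zero hlam))
    refine tendsto_nhdsWithin_iff.2 ⟨by simpa using this.1.mul_const v, ?_⟩
    filter_upwards [this.2] with h hh using mul_pos hh hv
  have hx0 : Tendsto (fun h : ℝ => h ^ lam * v) (𝓝[>] 0) (𝓝 0) :=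
    hx.mono_right nhdsWithin_le_nhds
  have hs : Tendsto (fun h : ℝ => 1 - h ^ lam * v) (𝓝[>] 0) (𝓝 1) := by
    simpa using hx0.const_sub 1
  have hp : Tendsto (fun u : ℝ => phiW (1 - u) / u ^ α) (𝓝[>] 0) (𝓝 A) := by
    have h1 := hW.expansion.tendsto_div_nhds_zero
    have h2 := h1.add_const A
    rw [zero_add] at h2
    refine h2.congr' ?_
    filter_upwards [self_mem_nhdsWithin] with u hu
    have := (Real.rpow_pos_of_pos hu α).ne'
    field_simp
    ring
  have hr : Tendsto (fun h : ℝ => (tailRatio k C lam0 lam mu ((1 - h ^ lam * v) / h))⁻¹) (𝓝[>] 0)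
      (𝓝 1) := by
    have h1 : Tendsto (fun h : ℝ => (1 - h ^ lam * v) / h) (𝓝[>] 0) atTop := by
      simp_rw [div_eq_mul_inv]
      exact hs.pos_mul_atTop zero_lt_one tendsto_inv_nhdsGT_zero
    have h2 := (hK.tendsto_tailRatio.mono_left atTop_le_cocompact).comp h1
    simpa using h2.inv₀ one_ne_zero
  have hpow : Tendsto (fun h : ℝ => (1 - h ^ lam * v) ^ (-(lam0 + 1))) (𝓝[>] 0) (𝓝 1) := by
    simpa using hs.rpow_const (p := -(lam0 + 1)) (Or.inl one_ne_zero)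
  have hmain := ((hp.comp hx).mul_const C⁻¹).mul ((hpow.const_mul (v ^ α)).mul
    ((Real.continuous_exp.tendsto _).comp (tendsto_exponent (mu := mu) hlam v)))
  have := ((Complex.continuous_ofReal.tendsto _).comp hmain).mul hr
  rw [mul_one] at this
  refine (this.congr' ?_).trans (le_of_eq ?_)
  -- The explicit formula holds once the point `1 - h ^ lam * v` has passed the cutoff `ρ`.
  · filter_upwards [self_mem_nhdsWithin, hs.eventually_const_lt hρ1] with h hh h1
    rw [edgeProfile_eq hK.C_ne_zero hρ hh hv h1]
    rfl
  · rw [← div_eq_mul_inv A C, mul_one (v ^ α), div_mul_eq_mul_div lam mu v]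

/-- Domination of the normalized integrand. -/
theorem eventually_norm_edgeProfile_le {A : ℝ}
    (hK : ConditionK k C lam0 lam mu) (hρ : 1 / 2 ≤ ρ)
    (hb : ∀ u, 0 < u → u < 1 - ρ → |phiW (1 - u)| ≤ (|A| + 1) * u ^ α) :
    ∀ᶠ h in 𝓝[>] (0 : ℝ), ∀ v, ‖edgeProfile phiW k α lam0 lam mu ρ h v‖ ≤
      (Set.Ioi (0 : ℝ)).indicator (fun v => (|A| + 1) * |C|⁻¹ * 2 ^ |lam0 + 1| * 2 *
        (v ^ α * Real.exp (-(1 / mu * v)))) v := by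
  have hmu := hK.mu_pos
  -- The factor `2` is any constant above the limit `1`. It is available for every `s > ρ ≥ 1 / 2`
  -- as soon as `1 / (2 h) ≥ T`.
  have hev : ∀ᶠ t in atTop, ‖(tailRatio k C lam0 lam mu t)⁻¹‖ ≤ 2 :=
    (((hK.tendsto_tailRatio.mono_left atTop_le_cocompact).inv₀ one_ne_zero).norm).eventually_le_const
      (by simp)
  obtain ⟨T, hT⟩ := eventually_atTop.1 hev
  have hh2 : ∀ᶠ h in 𝓝[>] (0 : ℝ), T ≤ 1 / 2 * h⁻¹ :=
    (tendsto_inv_nhdsGT_zero.const_mul_atTop (by norm_num : (0 : ℝ) < 1 / 2)).eventually_ge_atTop T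
  filter_upwards [self_mem_nhdsWithin, hh2] with h hh hT2 v
  have hh : 0 < h := hh
  rcases le_or_gt v 0 with hv | hv
  · rw [edgeProfile_eq_zero hh hv, Set.indicator_of_notMem (by simpa using hv), norm_zero]
  rw [Set.indicator_of_mem (show v ∈ Set.Ioi (0 : ℝ) from hv)]
  have hhl := Real.rpow_pos_of_pos hh lam
  have hx : 0 < h ^ lam * v := mul_pos hhl hv
  by_cases hvρ : ρ < 1 - h ^ lam * v
  swap
  · rw [edgeProfile, edgeIntegrand, Set.indicator_of_notMem fun h => hvρ h.1, mul_zero, norm_zero]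
    positivity
  set s := 1 - h ^ lam * v with hsdef
  have hs : 0 < s := by linarith
  have hs1 : s ≤ 1 := by linarith
  rw [edgeProfile_eq hK.C_ne_zero (by linarith) hh hv hvρ, norm_mul,
    Complex.norm_real, Real.norm_eq_abs, abs_mul, abs_mul, abs_inv, abs_div,
    abs_of_pos (Real.rpow_pos_of_pos hx α), ← hsdef]
  have b1 : |phiW s| / (h ^ lam * v) ^ α ≤ |A| + 1 := by
    rw [div_le_iff₀ (Real.rpow_pos_of_pos hx α)]
    exact hb _ hx (by linarith)
  have b2 : ‖(tailRatio k C lam0 lam mu (s / h))⁻¹‖ ≤ 2 := by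
    refine hT _ (hT2.trans ?_)
    rw [div_eq_mul_inv]
    exact mul_le_mul_of_nonneg_right (by linarith) (inv_pos.2 hh).le
  -- Here `s ≥ 1 / 2`; the absolute value covers both signs of `lam0 + 1`.
  have b3 : s ^ (-(lam0 + 1)) ≤ 2 ^ |lam0 + 1| := by
    have : s ^ (-(lam0 + 1)) ≤ s ^ (-|lam0 + 1|) :=
      Real.rpow_le_rpow_of_exponent_ge hs hs1 (neg_le_neg (le_abs_self _))
    refine this.trans ?_
    rw [Real.rpow_neg hs.le, ← Real.inv_rpow hs.le]
    refine Real.rpow_le_rpow (inv_pos.2 hs).le ?_ (abs_nonneg _)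
    rw [inv_le_comm₀ hs (by norm_num)]
    linarith
  have b4 : Real.exp ((s ^ lam - 1) / h ^ lam / mu) ≤ Real.exp (-(1 / mu * v)) := by
    refine Real.exp_le_exp.2 ?_
    -- As `s ≤ 1 ≤ lam`, this gives `s ^ lam - 1 ≤ -h ^ lam * v`. The resulting decay rate `1 / mu`
    -- is weaker than the limiting `lam / mu` but suffices for domination.
    have : s ^ lam ≤ s := by
      simpa using Real.rpow_le_rpow_of_exponent_ge hs hs1 hK.one_lt_lam.le
    rw [show -(1 / mu * v) = (-v) / mu by ring]
    refine div_le_div_of_nonneg_right ?_ hmu.le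
    rw [div_le_iff₀ hhl]
    linarith
  have hva := Real.rpow_nonneg hv.le α
  have b5 : |v ^ α * s ^ (-(lam0 + 1)) * Real.exp ((s ^ lam - 1) / h ^ lam / mu)| ≤
      v ^ α * 2 ^ |lam0 + 1| * Real.exp (-(1 / mu * v)) := by
    rw [abs_of_nonneg (by positivity)]
    gcongr
  calc _ ≤ (|A| + 1) * |C|⁻¹ * (v ^ α * 2 ^ |lam0 + 1| * Real.exp (-(1 / mu * v))) * 2 := by
        gcongr
    _ = _ := by ring

end Edge

/-! ### Gamma integrals, the `L¹` limit of the profile and its Fourier transform -/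

section Gamma

variable {α c : ℝ}

theorem integrableOn_rpow_mul_exp_neg (hα : 0 ≤ α) (hc : 0 < c) :
    IntegrableOn (fun v : ℝ => v ^ α * Real.exp (-(c * v))) (Set.Ioi 0) := by
  have := integrableOn_rpow_mul_exp_neg_mul_rpow (s := α) (p := 1) (b := c) (by linarith) zero_lt_one hc
  simpa using this

theorem integral_rpow_mul_exp_neg (hα : 0 ≤ α) (hc : 0 < c) :
    ∫ v in Set.Ioi (0 : ℝ), v ^ α * Real.exp (-(c * v)) =
      (1 / c) ^ (α + 1) * Real.Gamma (α + 1) := by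
  have := Real.integral_rpow_mul_exp_neg_mul_Ioi (a := α + 1) (r := c) (by linarith) hc
  simpa using this

end Gamma

section Limit

/-- The limit of the normalized integrand. -/
noncomputable def limitProfile (A C α c : ℝ) : ℝ → ℂ :=
  (Set.Ioi 0).indicator fun v => ((A / C * (v ^ α * Real.exp (-(c * v))) : ℝ) : ℂ)

theorem integrable_limitProfile {A C α c : ℝ} (hα : 0 ≤ α) (hc : 0 < c) :
    Integrable (limitProfile A C α c) := by
  rw [limitProfile, integrable_indicator_iff measurableSet_Ioi]
  exact ((integrableOn_rpow_mul_exp_neg hα hc).const_mul _).ofReal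

theorem integral_limitProfile {A C α c : ℝ} (hα : 0 ≤ α) (hc : 0 < c) :
    ∫ v, limitProfile A C α c v =
      ((A / C * ((1 / c) ^ (α + 1) * Real.Gamma (α + 1)) : ℝ) : ℂ) := by
  rw [limitProfile, integral_indicator measurableSet_Ioi, integral_complex_ofReal,
    integral_const_mul, integral_rpow_mul_exp_neg hα hc]

variable {phiW k : ℝ → ℝ} {A C α lam0 lam mu ρ : ℝ}

/-- Convergence in `L¹` of the normalized integrand. -/
theorem tendsto_integral_norm_edgeProfile_sub [IsFiniteMeasure (densityLaw k)]
    (hi : Integrable phiW) (hW : ConditionW phiW A α) (hK : ConditionK k C lam0 lam mu)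
    (hρ : 1 / 2 ≤ ρ) (hρ1 : ρ < 1)
    (hb : ∀ u, 0 < u → u < 1 - ρ → |phiW (1 - u)| ≤ (|A| + 1) * u ^ α) :
    Tendsto (fun h => ∫ v, ‖edgeProfile phiW k α lam0 lam mu ρ h v -
      limitProfile A C α (lam / mu) v‖) (𝓝[>] 0) (𝓝 0) := by
  have hmu := hK.mu_pos
  have hlam : 0 < lam := zero_lt_one.trans hK.one_lt_lam
  have hρ0 : 0 < ρ := by linarith
  have hG : Integrable (limitProfile A C α (lam / mu)) :=
    integrable_limitProfile hW.alpha_nonneg (div_pos hlam hmu)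
  have hdom : Integrable ((Set.Ioi (0 : ℝ)).indicator (fun v => (|A| + 1) * |C|⁻¹ *
      2 ^ |lam0 + 1| * 2 * (v ^ α * Real.exp (-(1 / mu * v))))) := by
    rw [integrable_indicator_iff measurableSet_Ioi]
    exact (integrableOn_rpow_mul_exp_neg hW.alpha_nonneg (by positivity)).const_mul _
  rw [show 𝓝 (0 : ℝ) = 𝓝 (∫ _ : ℝ, (0 : ℝ)) by rw [integral_zero]]
  refine tendsto_integral_filter_of_dominated_convergence
    (fun v => (Set.Ioi (0 : ℝ)).indicator (fun v => (|A| + 1) * |C|⁻¹ *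
      2 ^ |lam0 + 1| * 2 * (v ^ α * Real.exp (-(1 / mu * v)))) v +
      ‖limitProfile A C α (lam / mu) v‖) ?_ ?_ (hdom.add hG.norm) ?_
  · filter_upwards [self_mem_nhdsWithin] with h hh
    exact ((integrable_edgeProfile hi hK.ne_zero hρ0 hh).sub hG).aestronglyMeasurable.norm
  · filter_upwards [eventually_norm_edgeProfile_le hK hρ hb] with h hh
    refine Eventually.of_forall fun v => ?_
    rw [norm_norm]
    exact (norm_sub_le _ _).trans (add_le_add (hh v) le_rfl)
  · refine Eventually.of_forall fun v => ?_
    rcases le_or_gt v 0 with hv | hv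
    · refine tendsto_const_nhds.congr' ?_
      filter_upwards [self_mem_nhdsWithin] with h hh
      rw [edgeProfile_eq_zero hh hv, limitProfile,
        Set.indicator_of_notMem (by simpa using hv), sub_zero, norm_zero]
    · have := (tendsto_edgeProfile hW hK hρ0 hρ1 hv).sub_const (limitProfile A C α (lam / mu) v)
      rw [limitProfile, Set.indicator_of_mem (show v ∈ Set.Ioi (0 : ℝ) from hv), sub_self] at this
      simpa [limitProfile, Set.indicator_of_mem (show v ∈ Set.Ioi (0 : ℝ) from hv)] using this.norm

/-- Fourier transform with the sign and scaling used in this file. -/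
noncomputable def fourierNeg (g : ℝ → ℂ) (ζ : ℝ) : ℂ :=
  ∫ v : ℝ, Complex.exp (-(Complex.I * ζ * v)) * g v

theorem integrable_exp_neg_mul {g : ℝ → ℂ} (hg : Integrable g) (ζ : ℝ) :
    Integrable fun v : ℝ => Complex.exp (-(Complex.I * ζ * v)) * g v :=
  hg.bdd_mul (c := 1) (by fun_prop) (Eventually.of_forall fun v => (norm_exp_neg_I_mul_mul ζ v).le)

theorem norm_fourierNeg_le (g : ℝ → ℂ) (ζ : ℝ) : ‖fourierNeg g ζ‖ ≤ ∫ v, ‖g v‖ := by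
  refine (norm_integral_le_integral_norm _).trans (le_of_eq ?_)
  simp_rw [norm_mul, norm_exp_neg_I_mul_mul, one_mul]

theorem fourierNeg_sub {g g' : ℝ → ℂ} (hg : Integrable g) (hg' : Integrable g') (ζ : ℝ) :
    fourierNeg g ζ - fourierNeg g' ζ = fourierNeg (fun v => g v - g' v) ζ := by
  rw [fourierNeg, fourierNeg, fourierNeg,
    ← integral_sub (integrable_exp_neg_mul hg ζ) (integrable_exp_neg_mul hg' ζ)]
  simp_rw [mul_sub]

theorem continuous_fourierNeg {g : ℝ → ℂ} (hg : Integrable g) : Continuous (fourierNeg g) := by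
  unfold fourierNeg
  refine continuous_of_dominated (bound := fun v => ‖g v‖)
    (fun ζ => (integrable_exp_neg_mul hg ζ).aestronglyMeasurable) (fun ζ => ?_) hg.norm ?_
  · exact Eventually.of_forall fun v => by rw [norm_mul, norm_exp_neg_I_mul_mul, one_mul]
  · exact Eventually.of_forall fun v => by fun_prop

/-- The Riemann–Lebesgue lemma, rescaled by `2 π`. Integrability is not required because the
integral of a nonintegrable function is `0`. -/
theorem tendsto_fourierNeg_atTop (g : ℝ → ℂ) : Tendsto (fourierNeg g) atTop (𝓝 0) := by
  have h1 := (Real.tendsto_integral_exp_smul_cocompact g).mono_left atTop_le_cocompact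
  have h2 : Tendsto (fun ζ : ℝ => ζ / (2 * Real.pi)) atTop atTop :=
    tendsto_id.atTop_div_const (by positivity)
  refine (h1.comp h2).congr fun ζ => ?_
  simp only [Function.comp_apply, fourierNeg, Circle.smul_def, Real.fourierChar_apply, smul_eq_mul]
  congr 1
  funext v
  congr 2
  push_cast
  have : (Real.pi : ℂ) ≠ 0 := by exact_mod_cast Real.pi_ne_zero
  field_simp

end Limit

/-! ### Splitting the kernel into edge terms and a remainder -/

section Decomposition

variable {phiW k : ℝ → ℝ} {α lam0 lam mu ρ : ℝ}

/-- The integral over the edge region in terms of the normalized integrand. -/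
theorem integral_edgeIntegrand_mul_exp {h : ℝ} (hh : 0 < h) (z : ℝ) :
    ∫ s : ℝ, edgeIntegrand phiW k ρ h s * Complex.exp (Complex.I * (s / h : ℝ) * z) =
      rate α lam0 lam mu h * (Complex.exp (Complex.I * (z / h : ℝ)) *
        fourierNeg (edgeProfile phiW k α lam0 lam mu ρ h) (h ^ (lam - 1) * z)) := by
  have hl := Real.rpow_pos_of_pos hh lam
  have hr : ((rate α lam0 lam mu h : ℝ) : ℂ) ≠ 0 := by exact_mod_cast (rate_pos hh).ne'
  set φ : ℝ → ℂ := fun s =>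
    edgeIntegrand phiW k ρ h s * Complex.exp (Complex.I * (s / h : ℝ) * z) with hφ
  have e1 : ∫ s, φ s = h ^ lam • ∫ v, φ (1 - h ^ lam * v) := by
    rw [Measure.integral_comp_mul_left (fun u => φ (1 - u)), integral_sub_left_eq_self φ volume 1,
      abs_of_pos (inv_pos.2 hl), smul_smul, mul_inv_cancel₀ hl.ne', one_smul]
  rw [e1, fourierNeg, ← integral_const_mul, ← integral_const_mul, ← integral_smul]
  refine integral_congr_ae (Eventually.of_forall fun v => ?_)
  -- The phase splits as `z / h - h ^ (lam - 1) * z * v`: a factor free of `v` and a slow frequency.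
  have e2 : Complex.exp (Complex.I * ((1 - h ^ lam * v) / h : ℝ) * z) =
      Complex.exp (Complex.I * (z / h : ℝ)) *
        Complex.exp (-(Complex.I * (h ^ (lam - 1) * z : ℝ) * v)) := by
    rw [← Complex.exp_add, Real.rpow_sub_one hh.ne']
    congr 1
    push_cast
    have : (h : ℂ) ≠ 0 := by exact_mod_cast hh.ne'
    field_simp
    ring
  simp only [hφ, e2, edgeProfile, Complex.real_smul]
  push_cast
  field_simp

/-- The bound is uniform in `ζ`; this matters because the frequencies to be inserted vary with `n`
and `x`. -/
theorem norm_edge_fourierNeg_sub_le [IsFiniteMeasure (densityLaw k)] {A C : ℝ}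
    (hi : Integrable phiW) (hα : 0 ≤ α) (hK : ConditionK k C lam0 lam mu) (hρ : 0 < ρ) {h : ℝ}
    (hh : 0 < h) (ζ : ℝ) :
    ‖fourierNeg (edgeProfile phiW k α lam0 lam mu ρ h) ζ -
      fourierNeg (limitProfile A C α (lam / mu)) ζ‖ ≤
      ∫ v, ‖edgeProfile phiW k α lam0 lam mu ρ h v - limitProfile A C α (lam / mu) v‖ := by
  rw [fourierNeg_sub (integrable_edgeProfile hi hK.ne_zero hρ hh) (integrable_limitProfile hα
    (div_pos (zero_lt_one.trans hK.one_lt_lam) hK.mu_pos))]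
  exact norm_fourierNeg_le _ _

/-- The integrand of `intervalKernel` in the variable `s = h t`. -/
noncomputable def scaledIntegrand (phiW k : ℝ → ℝ) (h a b x s : ℝ) : ℂ :=
  Complex.exp (Complex.I * (s / h : ℝ) * x) *
    (phiW s / phiK k (s / h) * ((h : ℂ)⁻¹ * intervalTransform a b (s / h)))

theorem integrable_scaledIntegrand {h : ℝ} (hh : 0 < h)
    (hr : Integrable (kernelRatio phiW k h)) (a b x : ℝ) :
    Integrable (scaledIntegrand phiW k h a b x) := by
  have := ((integrable_intervalKernel_integrand hr a b x).comp_mul_left'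
    (inv_pos.2 hh).ne').const_mul (h : ℂ)⁻¹
  refine this.congr (Eventually.of_forall fun s => ?_)
  have e : h⁻¹ * s = s / h := by ring
  simp only [scaledIntegrand, kernelRatio, e, mul_div_cancel₀ _ hh.ne']
  ring

/-- Beyond `ρ` the interval transform at `s / h` is replaced by its endpoint form. Its factor `h /
(i s)` cancels `h⁻¹`, puts `1 / s` into the edge integrand and yields the `-i` in front. -/
theorem intervalKernel_eq_add [IsFiniteMeasure (densityLaw k)] (hi : Integrable phiW)
    (hs : Function.support phiW ⊆ Set.Icc (-1) 1) (h0 : ∀ t, phiK k t ≠ 0)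
    (hW : ∀ t, phiW (-t) = phiW t) (hρ : 0 < ρ)
    {h : ℝ} (hh : 0 < h) (a b x : ℝ) :
    intervalKernel phiW k h a b x = 1 / Real.pi *
      ((∫ s in Set.Ioc 0 ρ, scaledIntegrand phiW k h a b x s) - Complex.I *
        (rate α lam0 lam mu h * (Complex.exp (Complex.I * ((x - a) / h : ℝ)) *
          fourierNeg (edgeProfile phiW k α lam0 lam mu ρ h) (h ^ (lam - 1) * (x - a)) -
          Complex.exp (Complex.I * ((x - b) / h : ℝ)) *
          fourierNeg (edgeProfile phiW k α lam0 lam mu ρ h) (h ^ (lam - 1) * (x - b))))).re := by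
  have hr := integrable_kernelRatio hi hs h0 hh
  have hF := integrable_scaledIntegrand hh hr a b x
  rw [intervalKernel_eq_integral_Ioi hW hh hr]
  congr 2
  change ∫ s in Set.Ioi (0 : ℝ), scaledIntegrand phiW k h a b x s = _
  rw [← Set.Ioc_union_Ioi_eq_Ioi hρ.le, setIntegral_union Set.Ioc_disjoint_Ioi_same
    measurableSet_Ioi hF.integrableOn hF.integrableOn, sub_eq_add_neg]
  congr 1
  have hsub : ∫ s in Set.Ioi ρ, scaledIntegrand phiW k h a b x s =
      ∫ s in Set.Ioc ρ 1, scaledIntegrand phiW k h a b x s := by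
    refine (setIntegral_eq_of_subset_of_forall_sdiff_eq_zero measurableSet_Ioi
      Set.Ioc_subset_Ioi_self fun s hs' => ?_)
    have : phiW s = 0 := by
      by_contra hne
      exact hs'.2 ⟨hs'.1, (hs hne).2⟩
    simp [scaledIntegrand, this]
  have hint : ∀ z : ℝ, Integrable fun s : ℝ =>
      edgeIntegrand phiW k ρ h s * Complex.exp (Complex.I * (s / h : ℝ) * z) := fun z =>
    (integrable_edgeIntegrand hi h0 hρ h).mul_bdd (c := 1) (by fun_prop)
      (Eventually.of_forall fun s => (norm_exp_I_mul_mul _ z).le)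
  have ea := integral_edgeIntegrand_mul_exp (phiW := phiW) (k := k) (α := α) (lam0 := lam0)
    (lam := lam) (mu := mu) (ρ := ρ) hh (x - a)
  have eb := integral_edgeIntegrand_mul_exp (phiW := phiW) (k := k) (α := α) (lam0 := lam0)
    (lam := lam) (mu := mu) (ρ := ρ) hh (x - b)
  -- The endpoint `s = 1` is a null set, so `phiW 1` plays no role.
  rw [hsub, integral_Ioc_eq_integral_Ioo, ← integral_indicator measurableSet_Ioo, mul_sub, ← ea,
    ← eb, ← integral_sub (hint _) (hint _), ← integral_const_mul, ← integral_neg]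
  refine integral_congr_ae (Eventually.of_forall fun s => ?_)
  by_cases hs' : s ∈ Set.Ioo ρ 1
  · have hs0 : s ≠ 0 := (hρ.trans hs'.1).ne'
    simp only [Set.indicator_of_mem hs', edgeIntegrand, scaledIntegrand,
      intervalTransform_eq a b (div_ne_zero hs0 hh.ne')]
    have e : ∀ y : ℝ, Complex.exp (Complex.I * (s / h : ℝ) * ((x - y : ℝ) : ℂ)) =
        Complex.exp (Complex.I * (s / h : ℝ) * x) * Complex.exp (-(Complex.I * (s / h : ℝ) * y)) :=
      fun y => by rw [← Complex.exp_add]; congr 1; push_cast; ring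
    rw [e a, e b]
    have h1 : (h : ℂ) ≠ 0 := by exact_mod_cast hh.ne'
    have h2 : (s : ℂ) ≠ 0 := by exact_mod_cast hs0
    have h3 := h0 (s / h)
    rw [Complex.ofReal_div]
    field_simp
    rw [Complex.I_sq]
    ring
  · simp [edgeIntegrand, Set.indicator_of_notMem hs']

/-- Bound for the part of the integral away from the edge. -/
theorem norm_setIntegral_scaledIntegrand_le (hi : Integrable phiW) (hlam : 0 < lam) (hmu : 0 < mu)
    {γ M ε : ℝ} (hγ : 0 < γ) (hM : 0 ≤ M)
    (hb : ∀ t, ‖(phiK k t)⁻¹‖ ≤ M * Real.exp (γ * |t| ^ lam / mu)) (hε : 0 < ε) {h : ℝ}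
    (hh : 0 < h) (a b x : ℝ) :
    ‖∫ s in Set.Ioc 0 ρ, scaledIntegrand phiW k h a b x s‖ ≤
      (∫ s, ‖phiW s‖) * (M * Real.exp (γ * (ε / h) ^ lam / mu) * (h⁻¹ * |b - a|) +
        M * Real.exp (γ * (ρ / h) ^ lam / mu) * (2 / ε)) := by
  set B := M * Real.exp (γ * (ε / h) ^ lam / mu) * (h⁻¹ * |b - a|) +
        M * Real.exp (γ * (ρ / h) ^ lam / mu) * (2 / ε) with hB
  have hB0 : 0 ≤ B := by positivity
  have hle : ∀ s r : ℝ, 0 < s → s ≤ r → ‖(phiK k (s / h))⁻¹‖ ≤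
      M * Real.exp (γ * (r / h) ^ lam / mu) := fun s r h0 hr => by
    refine (hb _).trans ?_
    rw [abs_of_pos (div_pos h0 hh)]
    gcongr
  have hpt : ∀ s ∈ Set.Ioc 0 ρ, ‖scaledIntegrand phiW k h a b x s‖ ≤ ‖phiW s‖ * B := by
    rintro s ⟨hs0, hsρ⟩
    rw [scaledIntegrand, norm_mul, norm_exp_I_mul_mul, one_mul, div_eq_mul_inv, mul_assoc,
      norm_mul, Complex.norm_real]
    refine mul_le_mul_of_nonneg_left ?_ (norm_nonneg _)
    rw [norm_mul, norm_mul, norm_inv (h : ℂ), Complex.norm_real, Real.norm_eq_abs, abs_of_pos hh]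
    -- Below `ε` the interval transform is bounded by `|b - a|`, above it by `2 / |t|`.
    rcases le_or_gt s ε with hsε | hsε
    · refine le_trans ?_ (le_add_of_nonneg_right (by positivity))
      exact mul_le_mul (hle s ε hs0 hsε) (mul_le_mul_of_nonneg_left
        (norm_intervalTransform_le _ _ _) (inv_pos.2 hh).le) (by positivity) (by positivity)
    · refine le_trans ?_ (le_add_of_nonneg_left (by positivity))
      refine mul_le_mul (hle s ρ hs0 hsρ) ?_ (by positivity) (by positivity)
      refine (mul_le_mul_of_nonneg_left (norm_intervalTransform_le_div a b
        (div_pos hs0 hh).ne') (inv_pos.2 hh).le).trans ?_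
      rw [abs_of_pos (div_pos hs0 hh)]
      have : h⁻¹ * (2 / (s / h)) = 2 / s := by field_simp
      rw [this]
      gcongr
  calc _ ≤ ∫ s in Set.Ioc 0 ρ, ‖phiW s‖ * B :=
        norm_integral_le_of_norm_le (hi.norm.mul_const B).integrableOn
          ((ae_restrict_iff' measurableSet_Ioc).2 (Eventually.of_forall hpt))
    _ ≤ ∫ s, ‖phiW s‖ * B :=
        setIntegral_le_integral (hi.norm.mul_const B)
          (Eventually.of_forall fun s => mul_nonneg (norm_nonneg _) hB0)
    _ = _ := integral_mul_const _ _

end Decomposition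

/-! ### Sine asymptotics of the normalized kernel -/

section Kernel

variable {phiW k : ℝ → ℝ} {A C α lam0 lam mu ρ : ℝ}

/-- The little-o term is at most `u ^ α` for small `u`, whence `|A| + 1`. Taking `ρ ≥ 1 / 2` keeps
the edge region away from `s = 0`. -/
theorem ConditionW.exists_bound (hW : ConditionW phiW A α) :
    ∃ ρ, 1 / 2 ≤ ρ ∧ ρ < 1 ∧
      ∀ u, 0 < u → u < 1 - ρ → |phiW (1 - u)| ≤ (|A| + 1) * u ^ α := by
  obtain ⟨η, hη, hsub⟩ := mem_nhdsGT_iff_exists_Ioo_subset.1 (hW.expansion.bound zero_lt_one)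
  have hη : 0 < η := hη
  refine ⟨1 - min η (1 / 2), ?_, ?_, fun u hu hu1 => ?_⟩
  · linarith [min_le_right η (1 / 2)]
  · linarith [lt_min hη (by norm_num : (0 : ℝ) < 1 / 2)]
  · have h1 := hsub ⟨hu, by linarith [min_le_left η (1 / 2)]⟩
    have hp := Real.rpow_pos_of_pos hu α
    simp only [Set.mem_ofPred_eq, Real.norm_eq_abs, one_mul, abs_of_pos hp] at h1
    calc |phiW (1 - u)| = |A * u ^ α + (phiW (1 - u) - A * u ^ α)| := by congr 1; ring
      _ ≤ |A| * u ^ α + u ^ α := (abs_add_le _ _).trans (by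
          rw [abs_mul, abs_of_pos hp]; linarith)
      _ = _ := by ring

/-- The bound for the part of the integral away from the edge is negligible. -/
theorem tendsto_remainder_div_rate (hlam : 0 < lam) (hmu : 0 < mu) {h a : ℕ → ℝ}
    (hh : Tendsto h atTop (𝓝[>] 0)) {δ : ℝ} (hδ0 : 0 < δ)
    (ha : a =o[atTop] fun n => Real.exp (1 / (mu * h n ^ lam) * (1 - δ))) (hδ1 : δ < 1)
    (b S M : ℝ) (hS : 0 ≤ S) (hM : 0 ≤ M) {γ ε : ℝ} (hε : 0 < ε) (hγε : γ * ε ^ lam = δ / 2)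
    (hρ : 0 < ρ) (hγρ : γ * ρ ^ lam < 1) :
    Tendsto (fun n => (S * (M * Real.exp (γ * (ε / h n) ^ lam / mu) * ((h n)⁻¹ * |b - a n|) +
      M * Real.exp (γ * (ρ / h n) ^ lam / mu) * (2 / ε))) / rate α lam0 lam mu (h n)) atTop
      (𝓝 0) := by
  set β := (1 + α) * lam + lam0 with hβ
  -- Exponents in units of `1 / (mu * h ^ lam)`: for `s ≤ ε` they are `δ / 2` from `1 / phiK`, `1 -
  -- δ` from `|b - a|` and `-1` from `rate`, in total `-δ / 2`. For the other term the total is `γ *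
  -- ρ ^ lam - 1 < 0`.
  have t1 := ((tendsto_rpow_mul_exp_neg_div_rpow (-1 - β) (c := δ / 2 / mu) (by positivity)
    hlam).comp hh).const_mul (S * M * (1 + |b|))
  have t2 := ((tendsto_rpow_mul_exp_neg_div_rpow (-β) (c := (1 - γ * ρ ^ lam) / mu)
    (div_pos (sub_pos.2 hγρ) hmu) hlam).comp hh).const_mul (S * M * (2 / ε))
  have t3 := t1.add t2
  simp only [mul_zero, add_zero] at t3
  have hpos : ∀ᶠ n in atTop, 0 < h n := (tendsto_nhdsWithin_iff.1 hh).2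
  refine squeeze_zero' ?_ ?_ t3
  · filter_upwards [hpos] with n hn
    have := rate_pos (α := α) (lam0 := lam0) (lam := lam) (mu := mu) hn
    positivity
  · filter_upwards [hpos, ha.bound zero_lt_one] with n hn han
    have hl := Real.rpow_pos_of_pos hn lam
    have hE1 : 1 ≤ Real.exp (1 / (mu * h n ^ lam) * (1 - δ)) := Real.one_le_exp
      (mul_nonneg (by positivity) (by linarith))
    have hba : |b - a n| ≤ (1 + |b|) * Real.exp (1 / (mu * h n ^ lam) * (1 - δ)) := by
      rw [one_mul, Real.norm_eq_abs, Real.norm_eq_abs, Real.abs_exp] at han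
      refine (abs_sub _ _).trans ?_
      nlinarith [abs_nonneg b]
    have hrp := rate_pos (α := α) (lam0 := lam0) (lam := lam) (mu := mu) hn
    have d : ∀ r : ℝ, 0 < r → γ * (r / h n) ^ lam / mu = γ * r ^ lam / mu / h n ^ lam := by
      intro r hr
      rw [Real.div_rpow hr.le hn.le]
      ring
    have r1 : (h n) ^ (-1 - β) = (h n)⁻¹ * ((h n) ^ β)⁻¹ := by
      rw [sub_eq_add_neg, Real.rpow_add hn, Real.rpow_neg_one, Real.rpow_neg hn.le]
    have r2 : (h n) ^ (-β) = ((h n) ^ β)⁻¹ := Real.rpow_neg hn.le _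
    have x1 : Real.exp (-(δ / 2 / mu / h n ^ lam)) = Real.exp (γ * (ε / h n) ^ lam / mu) *
        Real.exp (1 / (mu * h n ^ lam) * (1 - δ)) * (Real.exp (1 / (mu * h n ^ lam)))⁻¹ := by
      rw [← Real.exp_neg, ← Real.exp_add, ← Real.exp_add, d ε hε, hγε]
      congr 1
      field_simp
      ring
    have x2 : Real.exp (-((1 - γ * ρ ^ lam) / mu / h n ^ lam)) =
        Real.exp (γ * (ρ / h n) ^ lam / mu) * (Real.exp (1 / (mu * h n ^ lam)))⁻¹ := by
      rw [← Real.exp_neg, ← Real.exp_add, d ρ hρ]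
      congr 1
      field_simp
      ring
    simp only [Function.comp_apply]
    rw [r1, r2, x1, x2, div_eq_mul_inv]
    have hri : (rate α lam0 lam mu (h n))⁻¹ =
        ((h n) ^ β)⁻¹ * (Real.exp (1 / (mu * h n ^ lam)))⁻¹ := by rw [rate, mul_inv]
    calc _ ≤ (S * (M * Real.exp (γ * (ε / h n) ^ lam / mu) * ((h n)⁻¹ *
          ((1 + |b|) * Real.exp (1 / (mu * h n ^ lam) * (1 - δ)))) +
          M * Real.exp (γ * (ρ / h n) ^ lam / mu) * (2 / ε))) *
          (rate α lam0 lam mu (h n))⁻¹ := by gcongr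
      _ = _ := by rw [hri]; ring

/-- The normalized functions `intervalKernel` are asymptotic to a sine function of increasing
frequency, pointwise and boundedly. -/
theorem intervalKernel_asymptotics [IsFiniteMeasure (densityLaw k)] (hi : Integrable phiW)
    (hW : ConditionW phiW A α) (hK : ConditionK k C lam0 lam mu) {h a : ℕ → ℝ}
    (hh : Tendsto h atTop (𝓝[>] 0))
    (ha : Tendsto (fun n => a n * h n ^ (lam - 1)) atTop atBot) {δ : ℝ} (hδ0 : 0 < δ)
    (hδ1 : δ < 1) (ha' : a =o[atTop] fun n => Real.exp (1 / (mu * h n ^ lam) * (1 - δ))) (b : ℝ) :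
    (∃ M, ∀ᶠ n in atTop, ∀ x,
      |intervalKernel phiW k (h n) (a n) b x / rate α lam0 lam mu (h n)| ≤ M) ∧
    ∀ x, Tendsto (fun n => intervalKernel phiW k (h n) (a n) b x / rate α lam0 lam mu (h n) +
      A / C * ((mu / lam) ^ (α + 1) * Real.Gamma (α + 1)) / Real.pi *
        Real.sin ((h n)⁻¹ * (x - b))) atTop (𝓝 0) := by
  have hmu := hK.mu_pos
  have hlam : 0 < lam := zero_lt_one.trans hK.one_lt_lam
  have hα := hW.alpha_nonneg
  obtain ⟨ρ, hρ2, hρ1, hb⟩ := hW.exists_bound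
  have hρ : 0 < ρ := by linarith
  have hpos : ∀ᶠ n in atTop, 0 < h n := (tendsto_nhdsWithin_iff.1 hh).2
  -- constants for the remainder
  have hρl : 0 < ρ ^ lam := Real.rpow_pos_of_pos hρ _
  have hρl1 : ρ ^ lam < 1 := Real.rpow_lt_one hρ.le hρ1 hlam
  -- `γ > 1` is needed for the global bound on `1 / phiK`, and `γ < ρ ^ (-lam)` for the remainder to
  -- be negligible.
  obtain ⟨γ, hγ1, hγρ⟩ : ∃ γ, 1 < γ ∧ γ * ρ ^ lam < 1 := by
    obtain ⟨γ, h1, h2⟩ := exists_between ((one_lt_inv₀ hρl).2 hρl1)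
    exact ⟨γ, h1, by rwa [← lt_div_iff₀ hρl, one_div]⟩
  have hγ : 0 < γ := by linarith
  obtain ⟨M, hM, hMb⟩ := hK.exists_norm_inv_le hγ1
  obtain ⟨ε, hε, hγε⟩ : ∃ ε : ℝ, 0 < ε ∧ γ * ε ^ lam = δ / 2 := by
    refine ⟨(δ / 2 / γ) ^ lam⁻¹, by positivity, ?_⟩
    rw [← Real.rpow_mul (by positivity), inv_mul_cancel₀ hlam.ne', Real.rpow_one]
    field_simp
  set rem : ℕ → ℝ := fun n => ((∫ s, ‖phiW s‖) * (M * Real.exp (γ * (ε / h n) ^ lam / mu) *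
    ((h n)⁻¹ * |b - a n|) + M * Real.exp (γ * (ρ / h n) ^ lam / mu) * (2 / ε))) /
    rate α lam0 lam mu (h n) with hrem
  have hrem0 : Tendsto rem atTop (𝓝 0) := tendsto_remainder_div_rate hlam hmu hh hδ0 ha' hδ1 b _ M
    (integral_nonneg fun _ => norm_nonneg _) hM hε hγε hρ hγρ
  -- the edge terms
  set E : ℕ → ℝ := fun n => ∫ v, ‖edgeProfile phiW k α lam0 lam mu ρ (h n) v -
    limitProfile A C α (lam / mu) v‖ with hE
  have hE0 : Tendsto E atTop (𝓝 0) :=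
    (tendsto_integral_norm_edgeProfile_sub hi hW hK hρ2 hρ1 hb).comp hh
  set Q : ℕ → ℝ → ℂ := fun n ζ => fourierNeg (edgeProfile phiW k α lam0 lam mu ρ (h n)) ζ with hQ
  set G := limitProfile A C α (lam / mu) with hG
  have hGi : Integrable G := integrable_limitProfile hα (div_pos hlam hmu)
  have hQE : ∀ᶠ n in atTop, ∀ ζ, ‖Q n ζ - fourierNeg G ζ‖ ≤ E n := by
    filter_upwards [hpos] with n hn ζ using norm_edge_fourierNeg_sub_le hi hα hK hρ hn ζ
  set R : ℕ → ℝ → ℂ := fun n x =>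
    (∫ s in Set.Ioc 0 ρ, scaledIntegrand phiW k (h n) (a n) b x s) /
      (rate α lam0 lam mu (h n) : ℂ) with hR
  have hRb : ∀ᶠ n in atTop, ∀ x, ‖R n x‖ ≤ rem n := by
    filter_upwards [hpos] with n hn x
    have hrp := rate_pos (α := α) (lam0 := lam0) (lam := lam) (mu := mu) hn
    rw [hR, norm_div, Complex.norm_real, Real.norm_eq_abs, abs_of_pos hrp]
    exact div_le_div_of_nonneg_right (norm_setIntegral_scaledIntegrand_le hi hlam hmu hγ hM hMb hε
      hn _ _ _) hrp.le
  have hT : ∀ᶠ n in atTop, ∀ x,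
      intervalKernel phiW k (h n) (a n) b x / rate α lam0 lam mu (h n) = 1 / Real.pi *
      (R n x - Complex.I * (Complex.exp (Complex.I * ((x - a n) / h n : ℝ)) *
        Q n (h n ^ (lam - 1) * (x - a n)) - Complex.exp (Complex.I * ((x - b) / h n : ℝ)) *
        Q n (h n ^ (lam - 1) * (x - b)))).re := by
    filter_upwards [hpos] with n hn x
    have hrp := rate_pos (α := α) (lam0 := lam0) (lam := lam) (mu := mu) hn
    have hrc : (rate α lam0 lam mu (h n) : ℂ) ≠ 0 := by exact_mod_cast hrp.ne'
    rw [intervalKernel_eq_add (α := α) (lam0 := lam0) (lam := lam) (mu := mu) hi hW.support_subset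
      hK.ne_zero hW.symm hρ hn, mul_div_assoc, ← Complex.div_ofReal_re, sub_div,
      mul_left_comm Complex.I, mul_div_cancel_left₀ _ hrc]
  have hexp : ∀ y : ℝ, ‖Complex.exp (Complex.I * y)‖ = 1 := fun y => by
    rw [mul_comm]; exact Complex.norm_exp_ofReal_mul_I y
  constructor
  -- One unit bounds the remainder. Each endpoint term costs the `L¹` norm of `G` plus one unit for
  -- its `L¹` error.
  · refine ⟨1 / Real.pi * (1 + ((1 + ∫ v, ‖G v‖) + (1 + ∫ v, ‖G v‖))), ?_⟩
    filter_upwards [hT, hRb, hQE, hrem0.eventually_le_const zero_lt_one,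
      hE0.eventually_le_const zero_lt_one] with n hn hn1 hn2 hn3 hn4 x
    have hQb : ∀ ζ, ‖Q n ζ‖ ≤ 1 + ∫ v, ‖G v‖ := fun ζ => by
      calc ‖Q n ζ‖ = ‖(Q n ζ - fourierNeg G ζ) + fourierNeg G ζ‖ := by rw [sub_add_cancel]
        _ ≤ _ := (norm_add_le _ _).trans
          (add_le_add ((hn2 ζ).trans hn4) (norm_fourierNeg_le G ζ))
    rw [hn x, abs_mul, abs_of_pos (by positivity : 0 < 1 / Real.pi)]
    refine mul_le_mul_of_nonneg_left ((Complex.abs_re_le_norm _).trans ?_) (by positivity)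
    refine (norm_sub_le _ _).trans (add_le_add ((hn1 x).trans hn3) ?_)
    rw [norm_mul, Complex.norm_I, one_mul]
    refine (norm_sub_le _ _).trans (add_le_add ?_ ?_) <;>
    · rw [norm_mul, hexp, one_mul]
      exact hQb _
  · intro x
    set K : ℝ := A / C * ((mu / lam) ^ (α + 1) * Real.Gamma (α + 1)) with hKdef
    have hGint : fourierNeg G 0 = (K : ℂ) := by
      have : fourierNeg G 0 = ∫ v, G v := by simp [fourierNeg]
      rw [this, integral_limitProfile hα (div_pos hlam hmu), one_div_div]
    have hRlim : Tendsto (fun n => R n x) atTop (𝓝 0) :=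
      squeeze_zero_norm' (hRb.mono fun n hn => hn x) hrem0
    have hQlim : ∀ z : ℕ → ℝ, ∀ c : ℂ, Tendsto (fun n => fourierNeg G (z n)) atTop (𝓝 c) →
        Tendsto (fun n => Q n (z n)) atTop (𝓝 c) := fun z c hz => by
      have h1 : Tendsto (fun n => Q n (z n) - fourierNeg G (z n)) atTop (𝓝 0) :=
        squeeze_zero_norm' (hQE.mono fun n hn => hn _) hE0
      simpa using h1.add hz
    have hhl : Tendsto (fun n => h n ^ (lam - 1)) atTop (𝓝 0) :=
      ((tendsto_rpow_nhdsGT_zero (sub_pos.2 hK.one_lt_lam)).comp hh).mono_right nhdsWithin_le_nhds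
    -- At the endpoint `a` the frequency tends to infinity, so the term disappears by
    -- Riemann–Lebesgue.
    have hQa : Tendsto (fun n => Q n (h n ^ (lam - 1) * (x - a n))) atTop (𝓝 0) := by
      refine hQlim _ _ ((tendsto_fourierNeg_atTop G).comp ?_)
      have h1 := (hhl.mul_const x).add_atTop (tendsto_neg_atBot_atTop.comp ha)
      refine h1.congr fun n => ?_
      simp only [Function.comp_apply]
      ring
    -- At the endpoint `b` the frequency tends to `0`, so the term tends to the integral of `G`.
    have hQb : Tendsto (fun n => Q n (h n ^ (lam - 1) * (x - b))) atTop (𝓝 (K : ℂ)) := by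
      refine hQlim _ _ ?_
      rw [← hGint]
      refine ((continuous_fourierNeg hGi).tendsto 0).comp ?_
      simpa using hhl.mul_const (x - b)
    have hunit : ∀ (y : ℕ → ℝ) (u : ℕ → ℂ), Tendsto u atTop (𝓝 0) →
        Tendsto (fun n => Complex.exp (Complex.I * y n) * u n) atTop (𝓝 0) := fun y u hu => by
      refine squeeze_zero_norm (fun n => le_of_eq ?_) (tendsto_zero_iff_norm_tendsto_zero.1 hu)
      rw [norm_mul, hexp, one_mul]
    have hQb' : Tendsto (fun n => Q n (h n ^ (lam - 1) * (x - b)) - K) atTop (𝓝 0) := by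
      simpa using hQb.sub_const (K : ℂ)
    have hlim := hRlim.sub (((hunit (fun n => (x - a n) / h n) _ hQa).sub
      (hunit (fun n => (x - b) / h n) _ hQb')).const_mul Complex.I)
    simp only [sub_zero, mul_zero] at hlim
    have hlim2 := ((Complex.continuous_re.tendsto _).comp hlim).const_mul (1 / Real.pi)
    simp only [Complex.zero_re, mul_zero] at hlim2
    refine hlim2.congr' ?_
    filter_upwards [hT] with n hn
    have hsin : (Complex.I * (Complex.exp (Complex.I * ((x - b) / h n : ℝ)) * (K : ℂ))).re =
        -(K * Real.sin ((h n)⁻¹ * (x - b))) := by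
      rw [inv_mul_eq_div]
      generalize (x - b) / h n = y
      rw [mul_comm Complex.I (y : ℂ), Complex.exp_mul_I]
      simp [Complex.sin_ofReal_re, Complex.cos_ofReal_im, mul_comm K]
    have e : K / Real.pi * Real.sin ((h n)⁻¹ * (x - b)) = 1 / Real.pi *
        -(Complex.I * (Complex.exp (Complex.I * ((x - b) / h n : ℝ)) * (K : ℂ))).re := by
      rw [hsin]; ring
    rw [hn x, e, ← mul_add, ← Complex.neg_re, ← Complex.add_re]
    simp only [Function.comp_apply]
    congr 2
    ring

end Kernel

/-! ### Moments of a rapidly oscillating sine -/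

section Moments

variable {Ω : Type*} [MeasurableSpace Ω] {P : Measure Ω}

/-- The shift by `b` contributes only a unimodular factor. -/
theorem norm_integral_exp_sub {U : Ω → ℝ} (hU : AEMeasurable U P) (t b : ℝ) :
    ‖∫ ω, Complex.exp ((t * (U ω - b) : ℝ) * Complex.I) ∂P‖ = ‖charFun (P.map U) t‖ := by
  have e : ∀ ω, Complex.exp ((t * (U ω - b) : ℝ) * Complex.I) =
      Complex.exp ((-(t * b) : ℝ) * Complex.I) * Complex.exp (t * U ω * Complex.I) := fun ω => by
    rw [← Complex.exp_add]; congr 1; push_cast; ring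
  simp_rw [e]
  rw [integral_const_mul, norm_mul, Complex.norm_exp_ofReal_mul_I, one_mul, charFun_apply_real,
    integral_map hU (by fun_prop)]

variable [IsProbabilityMeasure P]

theorem integrable_exp_sub {U : Ω → ℝ} (hU : AEMeasurable U P) (t b : ℝ) :
    Integrable (fun ω => Complex.exp ((t * (U ω - b) : ℝ) * Complex.I)) P :=
  Integrable.of_bound ((Measurable.comp_aemeasurable
    (g := fun y : ℝ => Complex.exp ((t * (y - b) : ℝ) * Complex.I))
    (by fun_prop) hU).aestronglyMeasurable) 1
    (Eventually.of_forall fun ω => by rw [Complex.norm_exp_ofReal_mul_I])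

theorem abs_integral_cos_le {U : Ω → ℝ} (hU : AEMeasurable U P) (t b : ℝ) :
    |∫ ω, Real.cos (t * (U ω - b)) ∂P| ≤ ‖charFun (P.map U) t‖ := by
  rw [← norm_integral_exp_sub hU t b]
  refine le_trans (le_of_eq ?_) (Complex.abs_re_le_norm _)
  have := _root_.integral_re (𝕜 := ℂ) (integrable_exp_sub hU t b)
  simp only [RCLike.re_eq_complex_re, Complex.exp_ofReal_mul_I_re] at this
  rw [this]

theorem abs_integral_sin_le {U : Ω → ℝ} (hU : AEMeasurable U P) (t b : ℝ) :
    |∫ ω, Real.sin (t * (U ω - b)) ∂P| ≤ ‖charFun (P.map U) t‖ := by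
  rw [← norm_integral_exp_sub hU t b]
  refine le_trans (le_of_eq ?_) (Complex.abs_im_le_norm _)
  have := _root_.integral_im (𝕜 := ℂ) (integrable_exp_sub hU t b)
  simp only [RCLike.im_eq_complex_im, Complex.exp_ofReal_mul_I_im] at this
  rw [this]

theorem integrable_sin_pow {U : Ω → ℝ} (hU : AEMeasurable U P) (t b c : ℝ) (m : ℕ) :
    Integrable (fun ω => (c * Real.sin (t * (U ω - b))) ^ m) P := by
  refine Integrable.of_bound ((Measurable.comp_aemeasurable
    (g := fun y : ℝ => (c * Real.sin (t * (y - b))) ^ m)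
    (by fun_prop) hU).aestronglyMeasurable) (|c| ^ m) (Eventually.of_forall fun ω => ?_)
  rw [norm_pow, Real.norm_eq_abs, abs_mul]
  refine pow_le_pow_left₀ (by positivity) ?_ m
  exact mul_le_of_le_one_right (abs_nonneg c) (Real.abs_sin_le_one _)

/-- First and second moments of bounded functions that are asymptotic to a sine function of
increasing frequency. -/
theorem tendsto_moments {U : Ω → ℝ} (hU : Measurable U)
    (hchar : Tendsto (charFun (P.map U)) atTop (𝓝 0)) {τ : ℕ → ℝ} (hτ : Tendsto τ atTop atTop)
    {T : ℕ → ℝ → ℝ} (hT : ∀ n, Measurable (T n)) {M : ℝ} (hM : ∀ᶠ n in atTop, ∀ x, |T n x| ≤ M)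
    (b c : ℝ)
    (hlim : ∀ x, Tendsto (fun n => T n x + c * Real.sin (τ n * (x - b))) atTop (𝓝 0)) :
    Tendsto (fun n => ∫ ω, T n (U ω) ∂P) atTop (𝓝 0) ∧
    Tendsto (fun n => ∫ ω, T n (U ω) ^ 2 ∂P) atTop (𝓝 (c ^ 2 / 2)) := by
  have hTm : ∀ n, Measurable fun ω => T n (U ω) := fun n => (hT n).comp hU
  have hSm : ∀ n, Measurable fun ω => c * Real.sin (τ n * (U ω - b)) := fun n => by fun_prop
  have hSb : ∀ n x, |c * Real.sin (τ n * (x - b))| ≤ |c| := fun n x => by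
    rw [abs_mul]
    exact mul_le_of_le_one_right (abs_nonneg c) (Real.abs_sin_le_one _)
  have hSi : ∀ n, Integrable (fun ω => c * Real.sin (τ n * (U ω - b))) P := fun n => by
    simpa using integrable_sin_pow hU.aemeasurable (τ n) b c 1
  have hTi : ∀ᶠ n in atTop, Integrable (fun ω => T n (U ω)) P := by
    filter_upwards [hM] with n hn
    exact Integrable.of_bound (hTm n).aestronglyMeasurable M (Eventually.of_forall fun ω => hn _)
  have hTi2 : ∀ᶠ n in atTop, Integrable (fun ω => T n (U ω) ^ 2) P := by
    filter_upwards [hM] with n hn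
    refine Integrable.of_bound ((hTm n).pow_const 2).aestronglyMeasurable (M ^ 2)
      (Eventually.of_forall fun ω => ?_)
    rw [norm_pow]
    exact pow_le_pow_left₀ (norm_nonneg _) (hn _) 2
  have d1 : Tendsto (fun n => ∫ ω, (T n (U ω) + c * Real.sin (τ n * (U ω - b))) ∂P) atTop
      (𝓝 0) := by
    rw [show 𝓝 (0 : ℝ) = 𝓝 (∫ _ : Ω, (0 : ℝ) ∂P) by rw [integral_zero]]
    refine tendsto_integral_filter_of_dominated_convergence (fun _ => M + |c|)
      (Eventually.of_forall fun n => ((hTm n).add (hSm n)).aestronglyMeasurable) ?_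
      (integrable_const _) (Eventually.of_forall fun ω => hlim (U ω))
    filter_upwards [hM] with n hn
    exact Eventually.of_forall fun ω => (abs_add_le _ _).trans (add_le_add (hn _) (hSb n _))
  -- The difference of squares factors into the sum, which tends to `0` by `hlim`, and a bounded
  -- difference.
  have d2 : Tendsto (fun n => ∫ ω, (T n (U ω) ^ 2 - (c * Real.sin (τ n * (U ω - b))) ^ 2) ∂P)
      atTop (𝓝 0) := by
    rw [show 𝓝 (0 : ℝ) = 𝓝 (∫ _ : Ω, (0 : ℝ) ∂P) by rw [integral_zero]]
    refine tendsto_integral_filter_of_dominated_convergence (fun _ => (M + |c|) * (M + |c|))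
      (Eventually.of_forall fun n =>
        (((hTm n).pow_const 2).sub ((hSm n).pow_const 2)).aestronglyMeasurable) ?_
      (integrable_const _) (Eventually.of_forall fun ω => ?_)
    · filter_upwards [hM] with n hn
      refine Eventually.of_forall fun ω => ?_
      rw [sq_sub_sq, norm_mul]
      refine mul_le_mul ((abs_add_le _ _).trans (add_le_add (hn _) (hSb n _)))
        ((abs_sub _ _).trans (add_le_add (hn _) (hSb n _))) (norm_nonneg _) ?_
      exact add_nonneg ((abs_nonneg _).trans (hn (U ω))) (abs_nonneg c)
    · have := (hlim (U ω)).norm.mul_const (M + |c|)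
      rw [norm_zero, zero_mul] at this
      refine squeeze_zero_norm' ?_ this
      filter_upwards [hM] with n hn
      rw [sq_sub_sq, norm_mul]
      exact mul_le_mul_of_nonneg_left ((abs_sub _ _).trans (add_le_add (hn _) (hSb n _)))
        (norm_nonneg _)
  have s1 : Tendsto (fun n => ∫ ω, c * Real.sin (τ n * (U ω - b)) ∂P) atTop (𝓝 0) := by
    have h1 : Tendsto (fun n => ∫ ω, Real.sin (τ n * (U ω - b)) ∂P) atTop (𝓝 0) :=
      squeeze_zero_norm (fun n => abs_integral_sin_le hU.aemeasurable (τ n) b)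
        (by simpa using (hchar.comp hτ).norm)
    simpa [integral_const_mul] using h1.const_mul c
  have s2 : Tendsto (fun n => ∫ ω, (c * Real.sin (τ n * (U ω - b))) ^ 2 ∂P) atTop
      (𝓝 (c ^ 2 / 2)) := by
    -- Since `sin ^ 2 = (1 - cos) / 2` at the doubled angle, the limit `c ^ 2 / 2` comes from the
    -- constant part. The cosine average is bounded by the characteristic function at `2 * τ n`.
    have h1 : Tendsto (fun n => ∫ ω, Real.cos (2 * τ n * (U ω - b)) ∂P) atTop (𝓝 0) :=
      squeeze_zero_norm (fun n => abs_integral_cos_le hU.aemeasurable (2 * τ n) b)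
        (by simpa using (hchar.comp (hτ.const_mul_atTop zero_lt_two)).norm)
    have h2 : ∀ n, ∫ ω, (c * Real.sin (τ n * (U ω - b))) ^ 2 ∂P =
        c ^ 2 / 2 - c ^ 2 / 2 * ∫ ω, Real.cos (2 * τ n * (U ω - b)) ∂P := fun n => by
      have hcos : Integrable (fun ω => Real.cos (2 * τ n * (U ω - b))) P :=
        Integrable.of_bound (by fun_prop) 1 (Eventually.of_forall fun ω => Real.abs_cos_le_one _)
      have : ∀ ω, (c * Real.sin (τ n * (U ω - b))) ^ 2 =
          c ^ 2 / 2 - c ^ 2 / 2 * Real.cos (2 * τ n * (U ω - b)) := fun ω => by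
        rw [mul_pow, Real.sin_sq_eq_half_sub, mul_assoc 2]; ring
      simp_rw [this]
      rw [integral_sub (integrable_const _) (hcos.const_mul _), integral_const_mul]
      simp
    simp_rw [h2]
    simpa using (h1.const_mul (c ^ 2 / 2)).const_sub (c ^ 2 / 2)
  constructor
  · have := d1.sub s1
    rw [sub_zero] at this
    refine this.congr' ?_
    filter_upwards [hTi] with n hn
    rw [integral_add hn (hSi n), add_sub_cancel_right]
  · have := d2.add s2
    rw [zero_add] at this
    refine this.congr' ?_
    filter_upwards [hTi2] with n hn
    rw [integral_sub hn (integrable_sin_pow hU.aemeasurable (τ n) b c 2), sub_add_cancel]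

end Moments

/-! ### Consequences of the model and the centered limit theorem -/

section Model

variable {Ω : Type*} [MeasurableSpace Ω] {P : Measure Ω} {f k : ℝ → ℝ}
  {X Y Z : ℕ → Ω → ℝ}

theorem DeconvolutionModel.measurable_X (hm : DeconvolutionModel P f k X Y Z) (j : ℕ) :
    Measurable (X j) := by
  rw [show X j = fun ω => Y j ω + Z j ω from funext (hm.X_eq j)]
  exact (hm.measurable_Y j).add (hm.measurable_Z j)

variable [IsProbabilityMeasure P]

theorem DeconvolutionModel.isFiniteMeasure_densityLaw (hm : DeconvolutionModel P f k X Y Z) :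
    IsFiniteMeasure (densityLaw k) := by
  rw [← hm.law_Z 0]
  infer_instance

theorem DeconvolutionModel.charFun_map_X (hm : DeconvolutionModel P f k X Y Z) (j : ℕ) :
    charFun (P.map (X j)) = charFun (densityLaw f) * charFun (densityLaw k) := by
  rw [show X j = Y j + Z j from funext (hm.X_eq j), (hm.indep_Y_Z j).charFun_map_add_eq_mul
    (hm.measurable_Y j).aemeasurable (hm.measurable_Z j).aemeasurable, hm.law_Y, hm.law_Z]

/-- All `X j` have the same characteristic function, a product of those of `f` and `k`, and it
determines the law. -/
theorem DeconvolutionModel.identDistrib_X (hm : DeconvolutionModel P f k X Y Z) (j : ℕ) :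
    IdentDistrib (X j) (X 0) P P where
  aemeasurable_fst := (hm.measurable_X j).aemeasurable
  aemeasurable_snd := (hm.measurable_X 0).aemeasurable
  map_eq := by
    have := fun j => Measure.isProbabilityMeasure_map (μ := P) (hm.measurable_X j).aemeasurable
    exact Measure.ext_of_charFun (by rw [hm.charFun_map_X, hm.charFun_map_X])

/-- The factor coming from `Y` has modulus at most `1`, and `phiK` vanishes at infinity. -/
theorem DeconvolutionModel.tendsto_charFun_X (hm : DeconvolutionModel P f k X Y Z)
    {C lam0 lam mu : ℝ} (hK : ConditionK k C lam0 lam mu) :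
    Tendsto (charFun (P.map (X 0))) atTop (𝓝 0) := by
  have hY : IsProbabilityMeasure (densityLaw f) := by
    rw [← hm.law_Y 0]
    exact Measure.isProbabilityMeasure_map (hm.measurable_Y 0).aemeasurable
  have h1 := (hK.tendsto_phiK.mono_left atTop_le_cocompact).norm
  rw [norm_zero] at h1
  refine squeeze_zero_norm (fun t => ?_) h1
  rw [hm.charFun_map_X, Pi.mul_apply, norm_mul]
  exact mul_le_of_le_one_left (norm_nonneg _) (norm_charFun_le_one t)

theorem abs_integral_le_of_abs_le {U : Ω → ℝ} {M : ℝ} (hM : ∀ ω, |U ω| ≤ M) :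
    |∫ ω, U ω ∂P| ≤ M := by
  simpa using norm_integral_le_of_norm_le_const (μ := P) (f := U) (C := M)
    (Eventually.of_forall hM)

/-- Central limit theorem for the centered averages of `T n (X j)`. -/
theorem tendstoInDistribution_centered {T : ℕ → ℝ → ℝ} (hindep : iIndepFun X P)
    (hident : ∀ i, IdentDistrib (X i) (X 0) P P) (hT : ∀ n, Measurable (T n))
    (hTi : ∀ n, Integrable (fun ω => T n (X 0 ω)) P) {M : ℝ}
    (hM : ∀ᶠ n in atTop, ∀ x, |T n x| ≤ M) {v : ℝ}
    (h1 : Tendsto (fun n => ∫ ω, T n (X 0 ω) ∂P) atTop (𝓝 0))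
    (h2 : Tendsto (fun n => ∫ ω, T n (X 0 ω) ^ 2 ∂P) atTop (𝓝 v)) :
    TendstoInDistribution (fun (n : ℕ) ω => (√n)⁻¹ * ∑ j ∈ Finset.range n,
      (T n (X j ω) - ∫ ω', T n (X 0 ω') ∂P)) atTop id (fun _ => P)
      (gaussianReal 0 v.toNNReal) := by
  have hv : 0 ≤ v := ge_of_tendsto' h2 fun n => integral_nonneg fun ω => sq_nonneg _
  refine tendstoInDistribution_array (T := fun n x => T n x - ∫ ω', T n (X 0 ω') ∂P) hindep hident
    (fun n => (hT n).sub_const _) (M := M + M) ?_ (fun n => ?_) ?_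
  · filter_upwards [hM] with n hn x
    exact (abs_sub _ _).trans (add_le_add (hn x) (abs_integral_le_of_abs_le fun ω => hn _))
  · rw [integral_sub (hTi n) (integrable_const _)]
    simp
  · rw [Real.coe_toNNReal _ hv]
    -- The variance is the second moment minus the squared mean, and the mean tends to `0`.
    have h3 := h2.sub (h1.pow 2)
    rw [zero_pow two_ne_zero, sub_zero] at h3
    refine h3.congr' ?_
    filter_upwards [hM] with n hn
    have hi2 : Integrable (fun ω => T n (X 0 ω) ^ 2) P := by
      refine Integrable.of_bound (((hT n).comp_aemeasurable
        (hident 0).aemeasurable_fst).pow_const 2).aestronglyMeasurable (M ^ 2)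
        (Eventually.of_forall fun ω => ?_)
      rw [norm_pow]
      exact pow_le_pow_left₀ (norm_nonneg _) (hn _) 2
    set m := ∫ ω', T n (X 0 ω') ∂P
    have e : ∀ ω, (T n (X 0 ω) - m) ^ 2 = T n (X 0 ω) ^ 2 - 2 * m * T n (X 0 ω) + m ^ 2 :=
      fun ω => by ring
    simp_rw [e]
    have hi3 : Integrable (fun ω => T n (X 0 ω) ^ 2 - 2 * m * T n (X 0 ω)) P :=
      hi2.sub ((hTi n).const_mul _)
    rw [integral_add hi3 (integrable_const _),
      integral_sub hi2 ((hTi n).const_mul _), integral_const_mul]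
    simp
    ring

end Model

end Deconvolution

/-! ### Assembly of the main theorem -/

open Deconvolution

/-- Asymptotic normality of the deconvolution estimator of the probability of a long interval. The
normalized summands are uniformly bounded, so that the second moment of `X 0` is not needed, and
`a → -∞` is implied by `a h ^ (lam - 1) → -∞`. -/
theorem mainTheorem8 {Ω : Type*} [MeasurableSpace Ω] (P : Measure Ω) [IsProbabilityMeasure P]
    (f k : ℝ → ℝ) (X Y Z : ℕ → Ω → ℝ) (hmodel : Deconvolution.DeconvolutionModel P f k X Y Z)
    (hX2 : Integrable (fun ω => X 0 ω ^ 2) P)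
    (w phiW : ℝ → ℝ) (hw : Deconvolution.IsKernelTransform w phiW)
    (A α : ℝ) (hW : Deconvolution.ConditionW phiW A α)
    (C lam0 lam mu : ℝ) (hK : Deconvolution.ConditionK k C lam0 lam mu)
    (h : ℕ → ℝ) (h_pos : ∀ n, 0 < h n) (h_lim : Tendsto h atTop (𝓝 0))
    (a : ℕ → ℝ) (a_lim : Tendsto a atTop atBot)
    (ah_lim : Tendsto (fun n => a n * h n ^ (lam - 1)) atTop atBot)
    (δ : ℝ) (hδ0 : 0 < δ) (hδ1 : δ < 1)
    (a_small : a =o[atTop] fun n => Real.exp (1 / (mu * h n ^ lam) * (1 - δ)))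
    (b : ℝ) :
    (∀ n, Integrable
      (fun ω => Deconvolution.intervalEstimator phiW k n (h n) (fun j => X j ω) (a n) b) P) ∧
    TendstoInDistribution
      (fun (n : ℕ) (ω : Ω) =>
        Real.sqrt n / (h n ^ ((1 + α) * lam + lam0) * Real.exp (1 / (mu * h n ^ lam))) *
          (Deconvolution.intervalEstimator phiW k n (h n) (fun j => X j ω) (a n) b -
            ∫ ω', Deconvolution.intervalEstimator phiW k n (h n) (fun j => X j ω') (a n) b ∂P))
      atTop id (fun _ => P)
      (gaussianReal 0 (Real.toNNReal
        (A ^ 2 / (2 * Real.pi ^ 2 * C ^ 2) * (mu / lam) ^ (2 + 2 * α) *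
          Real.Gamma (α + 1) ^ 2))) := by
  have hfin := hmodel.isFiniteMeasure_densityLaw
  have hmu := hK.mu_pos
  have hlam : 0 < lam := zero_lt_one.trans hK.one_lt_lam
  have hh : Tendsto h atTop (𝓝[>] 0) :=
    tendsto_nhdsWithin_iff.2 ⟨h_lim, Eventually.of_forall h_pos⟩
  have hr : ∀ n, Integrable (kernelRatio phiW k (h n)) := fun n =>
    integrable_kernelRatio hw.1 hW.support_subset hK.ne_zero (h_pos n)
  have hrate : ∀ n, 0 < rate α lam0 lam mu (h n) := fun n => rate_pos (h_pos n)
  have hV : ∀ n, Continuous (intervalKernel phiW k (h n) (a n) b) := fun n =>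
    continuous_intervalKernel (hr n) (a n) b
  have hVi : ∀ n j, Integrable (fun ω => intervalKernel phiW k (h n) (a n) b (X j ω)) P :=
    fun n j => Integrable.of_bound
      ((hV n).measurable.comp (hmodel.measurable_X j)).aestronglyMeasurable _
      (Eventually.of_forall fun ω => norm_intervalKernel_le (hr n) (a n) b (X j ω))
  have hF : ∀ n ω, intervalEstimator phiW k n (h n) (fun j => X j ω) (a n) b =
      1 / n * ∑ j ∈ Finset.range n, intervalKernel phiW k (h n) (a n) b (X j ω) := fun n ω =>
    intervalEstimator_eq hW.symm (hr n) n _ (a n) b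
  have hFi : ∀ n, Integrable
      (fun ω => intervalEstimator phiW k n (h n) (fun j => X j ω) (a n) b) P := fun n => by
    simp_rw [hF]
    exact (integrable_finsetSum _ fun j _ => hVi n j).const_mul _
  refine ⟨hFi, ?_⟩
  set T : ℕ → ℝ → ℝ := fun n x =>
    intervalKernel phiW k (h n) (a n) b x / rate α lam0 lam mu (h n) with hTdef
  have hT : ∀ n, Measurable (T n) := fun n => ((hV n).div_const _).measurable
  have hTi : ∀ n, Integrable (fun ω => T n (X 0 ω)) P := fun n => (hVi n 0).div_const _
  obtain ⟨⟨M, hM⟩, hlim⟩ := intervalKernel_asymptotics hw.1 hW hK hh ah_lim hδ0 hδ1 a_small b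
  obtain ⟨h1, h2⟩ := tendsto_moments (hmodel.measurable_X 0) (hmodel.tendsto_charFun_X hK)
    (tendsto_inv_nhdsGT_zero.comp hh) hT hM b _ hlim
  -- Half the squared amplitude of the limiting sine is the stated variance.
  have hvar : (A / C * ((mu / lam) ^ (α + 1) * Real.Gamma (α + 1)) / Real.pi) ^ 2 / 2 =
      A ^ 2 / (2 * Real.pi ^ 2 * C ^ 2) * (mu / lam) ^ (2 + 2 * α) * Real.Gamma (α + 1) ^ 2 := by
    have e : (mu / lam) ^ (2 + 2 * α) = ((mu / lam) ^ (α + 1)) ^ 2 := by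
      rw [← Real.rpow_mul_natCast (div_pos hmu hlam).le]
      congr 1
      push_cast
      ring
    rw [e]
    have := hK.C_ne_zero
    have := Real.pi_ne_zero
    field_simp
  rw [hvar] at h2
  have hmain := tendstoInDistribution_centered hmodel.indep_X hmodel.identDistrib_X hT hTi hM h1 h2
  have hmean : ∀ n : ℕ, n ≠ 0 →
      ∫ ω', intervalEstimator phiW k n (h n) (fun j => X j ω') (a n) b ∂P =
        rate α lam0 lam mu (h n) * ∫ ω', T n (X 0 ω') ∂P := fun n hn => by
    simp_rw [hF]
    have hj : ∀ j, ∫ ω, intervalKernel phiW k (h n) (a n) b (X j ω) ∂P =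
        ∫ ω, intervalKernel phiW k (h n) (a n) b (X 0 ω) ∂P := fun j =>
      ((hmodel.identDistrib_X j).comp (hV n).measurable).integral_eq
    rw [integral_const_mul, integral_finsetSum _ fun j _ => hVi n j]
    simp_rw [hj, hTdef, integral_div]
    rw [Finset.sum_const, Finset.card_range, nsmul_eq_mul, mul_div_cancel₀ _ (hrate n).ne']
    field_simp
  have hstat : ∀ (n : ℕ) ω,
      Real.sqrt n / (h n ^ ((1 + α) * lam + lam0) * Real.exp (1 / (mu * h n ^ lam))) *
        (intervalEstimator phiW k n (h n) (fun j => X j ω) (a n) b -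
          ∫ ω', intervalEstimator phiW k n (h n) (fun j => X j ω') (a n) b ∂P) =
      (√n)⁻¹ * ∑ j ∈ Finset.range n, (T n (X j ω) - ∫ ω', T n (X 0 ω') ∂P) := fun n ω => by
    -- For `n = 0` both sides vanish, because `√0 = 0` and the sum is empty.
    rcases eq_or_ne n 0 with rfl | hn
    · simp
    have hn0 : (0 : ℝ) < n := by exact_mod_cast Nat.pos_of_ne_zero hn
    change Real.sqrt n / rate α lam0 lam mu (h n) * _ = _
    have hrp := (hrate n).ne'
    rw [hmean n hn, hF, Finset.sum_sub_distrib, Finset.sum_const, Finset.card_range, nsmul_eq_mul,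
      hTdef, ← Finset.sum_div]
    have hs : (√(n : ℝ))⁻¹ = √n / n := by
      rw [inv_eq_one_div, Real.sqrt_div_self']
    rw [hs]
    field_simp
  simp_rw [hstat]
  exact hmain
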